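/- Let $X$ be a finite set, let $X^*$ be the set of finite words over $X$ (the vertices of a rooted tree), and let $\mathrm{Aut}(X^*)$ be the group of bijections of $X^*$ that preserve the prefix relation in both directions. For $g\in\mathrm{Aut}(X^*)$ and $x\in X^*$, the section $g_x\in\mathrm{Aut}(X^*)$ is defined by $g(xw)=g(x)g_x(w)$, and $\psi_x(g):=g_x$. For $H\leq\mathrm{Aut}(X^*)$ and $Y\subseteq X^*$, $\mathrm{st}_H(Y)$ is the pointwise stabilizer of $Y$ in $H$, and $\mathrm{st}_H(n):=\mathrm{st}_H(X^n)$. For $K\leq \mathrm{Aut}(X^*)$ and a set $Y$ of pairwise prefix-incomparable words, $K^Y\leq\mathrm{Aut}(X^*)$ is the group acting as a copy of $K$ on each subtree rooted at a vertex of $Y$ and trivially elsewhere. Let $G\leq \mathrm{Aut}(X^*)$ be a finitely generated group such that: - $G$ is regular branch: $G$ is self-similar ($g_x\in G$ for all $g\in G$, $x\in X^*$), acts transitively on every level $X^n$, and has a normal subgroup $K$ of finite index such that $K^{\{x\}}\leq K$ for all $x\in X^*$ and $K^{X^n}$ has finite index in $G$ for all $n$; - $G$ is just infinite: $G$ is infinite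 and every proper quotient of $G$ is finite; - $G$ is strongly self-replicating: $G$ is self-similar and $\psi_x(\mathrm{st}_G(n))=G$ for all $n\geq 1$ and $x\in X^n$; - $G$ has well-approximated subgroups: $\bigcap_{n\geq 0}H\,\mathrm{st}_G(n)=H$ for every finitely generated $H\leq G$; - $G$ obeys the Grigorchuk--Nagnibeda alternative: for every finitely generated $H\leq G$, either $\psi_y(H)=\{h_y: h\in H\}$ is finite for some $y\in X^*$, or there is a spanning leaf set $Y$ (a finite set of pairwise prefix-incomparable words such that every sufficiently long word has a prefix in $Y$) such that $\mathrm{st}_H(Y)$ is an infra-direct product of $G^Y$, that is, $\psi_y(\mathrm{st}_H(Y))$ is a finite-index subgroup of $G$ for every $y\in Y$. Let $\mathrm{Sub}(G)$ be the space of subgroups of $G$ with the topology induced from the product topology on $\{0,1\}^G$. Its Cantor--Bendixson derivatives are $S^0=\mathrm{Sub}(G)$, $S^{\alpha+1}$ = the set of limit points of $S^\alpha$, and $S^\lambda=\bigcap_{\alpha<\lambda}S^\alpha$ for limit $\lambda$. The perfect kernel is the stable value of this sequence, and $\mathrm{rk_{CB}}(L)$ is the ordinal $\alpha$ with $L\in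 S^\alpha\setminus S^{\alpha+1}$ (infinite if there is none). The depth of $L\leq G$, $\mathrm{depth}(L)\in\mathbb{N}\cup\{\infty\}$, is the supremum of the $n\in\mathbb{N}$ for which there is a series of subgroups $G=H_0>H_1>\dots>H_n=L$ with $|H_i:H_{i+1}|=\infty$ for all $i<n$ (with $\sup\emptyset=0$, so that subgroups of finite index have depth $0$). If $L\leq G$ is not a member of the perfect kernel of $\mathrm{Sub}(G)$, then 1. $L$ is finitely generated, 2. $\mathrm{rk_{CB}}(L)<\omega$, and 3. $\mathrm{rk_{CB}}(L)=\mathrm{depth}(L)$. -/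

import Mathlib

open scoped Pointwise

universe u

namespace BranchSub

section CantorBendixsonRank

variable {S : Type u} [TopologicalSpace S]

open Classical in
/-- The Cantor--Bendixson rank of a point `x` of a space `S`: the ordinal `a` with
`x ∈ S^a \ S^(a+1)`, where `S^a` is the `a`-th Cantor--Bendixson derivative of `S`, and `⊤`
(infinite rank) if there is no such ordinal. -/
noncomputable def cbRank (x : S) : WithTop Ordinal.{u} :=
  if h : ∃ a : Ordinal.{u},
      x ∈ CantorBendixson.iteratedDerivedSet (Set.univ : Set S) a ∧
        x ∉ CantorBendixson.iteratedDerivedSet (Set.univ : Set S) (a + 1)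
  then ((Classical.choose h : Ordinal.{u}) : WithTop Ordinal.{u})
  else ⊤

theorem cbRank_eq_coe_iff (x : S) (a : Ordinal.{u}) :
    cbRank x = (a : WithTop Ordinal.{u}) ↔
      x ∈ CantorBendixson.iteratedDerivedSet (Set.univ : Set S) a ∧
        x ∉ CantorBendixson.iteratedDerivedSet (Set.univ : Set S) (a + 1) := by
  have key : ∀ b c : Ordinal.{u},
      x ∉ CantorBendixson.iteratedDerivedSet (Set.univ : Set S) (b + 1) →
      x ∈ CantorBendixson.iteratedDerivedSet (Set.univ : Set S) c → c ≤ b := by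
    intro b c hb hc
    by_contra hlt
    exact hb (CantorBendixson.iteratedDerivedSet_antitone _
      (Order.add_one_le_of_lt (not_le.mp hlt)) hc)
  unfold cbRank
  split_ifs with h
  · have hs := Classical.choose_spec h
    rw [WithTop.coe_inj]
    constructor
    · intro e
      rw [← e]
      exact hs
    · intro ha
      exact le_antisymm (key _ _ ha.2 hs.1) (key _ _ hs.2 ha.1)
  · constructor
    · intro e
      exact absurd e.symm (WithTop.coe_ne_top)
    · intro ha
      exact absurd ⟨a, ha⟩ h

end CantorBendixsonRank

section Groups

variable {A : Type*} [Group A]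

open Classical in
/-- The Chabauty topology on the space `Sub(A)` of subgroups of `A`: the topology induced from the
product topology on `{0,1}^A` by identifying a subgroup with its indicator function. -/
noncomputable instance chabautyTopology : TopologicalSpace (Subgroup A) :=
  TopologicalSpace.induced (fun (H : Subgroup A) (a : A) => decide (a ∈ H)) inferInstance

/-- There is a series `A = H_0 > H_1 > ⋯ > H_n = L` with `|H_i : H_{i+1}| = ∞` for all `i < n`
(in Mathlib, `relIndex` is `0` exactly when the index is infinite). -/
def HasInfiniteIndexChain (L : Subgroup A) (n : ℕ) : Prop :=
  ∃ H : ℕ → Subgroup A, H 0 = ⊤ ∧ H n = L ∧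
    ∀ i < n, H (i + 1) < H i ∧ (H (i + 1)).relIndex (H i) = 0

/-- The depth of `L` in `A`: the supremum in `ℕ ∪ {∞}` of the lengths of the series above (the
supremum of the empty set being `0`). -/
noncomputable def depth (L : Subgroup A) : ℕ∞ :=
  ⨆ (n : ℕ) (_ : HasInfiniteIndexChain L n), (n : ℕ∞)

/-- An infinite group all of whose proper quotients are finite. -/
def JustInfinite (A : Type*) [Group A] : Prop :=
  Infinite A ∧ ∀ N : Subgroup A, N.Normal → N ≠ ⊥ → Finite (A ⧸ N)

/-- `P` is an infra-direct product of `G^Y`, where `G` is a subgroup of an ambient group `A`: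
`P` is a subgroup of `G^Y`, and each coordinate projection of `P` has finite index in `G`. -/
def IsInfraDirect {Y : Type*} (G : Subgroup A) (P : Subgroup (Y → A)) : Prop :=
  P ≤ Subgroup.pi Set.univ (fun _ => G) ∧
    ∀ y : Y, (P.map (Pi.evalMonoidHom (fun _ : Y => A) y)).relIndex G ≠ 0

end Groups

section Trees

variable {X : Type u}

/-- The automorphism group `Aut(X^*)`: the bijections of the set `X^*` of finite words that
preserve the prefix relation in both directions. The group law is composition. -/
abbrev TreeAut (X : Type u) : Type u :=
  (List.IsPrefix : List X → List X → Prop) ≃r (List.IsPrefix : List X → List X → Prop)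

theorem apply_append (g : TreeAut X) (u w : List X) :
    g u ++ (g (u ++ w)).drop (g u).length = g (u ++ w) :=
  List.prefix_iff_eq_append.mp (g.map_rel_iff.mpr (List.prefix_append u w))

/-- The section `g_x` of `g` at `x`, i.e. the automorphism with `g (x w) = g(x) g_x(w)`. -/
def treeSection (x : List X) (g : TreeAut X) : TreeAut X where
  toFun w := (g (x ++ w)).drop (g x).length
  invFun w := (g.symm (g x ++ w)).drop x.length
  left_inv w := by
    simp only [apply_append, RelIso.symm_apply_apply, List.drop_left]
  right_inv w := by
    have h : x ++ (g.symm (g x ++ w)).drop x.length = g.symm (g x ++ w) := by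
      have := apply_append g.symm (g x) w
      rwa [RelIso.symm_apply_apply] at this
    simp only [h, RelIso.apply_symm_apply, List.drop_left]
  map_rel_iff' := by
    intro a b
    simp only [Equiv.coe_fn_mk]
    rw [← List.prefix_append_right_inj (g x), apply_append, apply_append, g.map_rel_iff,
      List.prefix_append_right_inj]

theorem apply_append_eq (g : TreeAut X) (x w : List X) :
    g (x ++ w) = g x ++ treeSection x g w :=
  (apply_append g x w).symm

theorem treeSection_one (x : List X) : treeSection x (1 : TreeAut X) = 1 := by
  ext1 w
  have h := apply_append_eq (1 : TreeAut X) x w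
  simp only [RelIso.one_apply] at h ⊢
  exact (List.append_cancel_left h).symm

theorem treeSection_mul (x : List X) (g h : TreeAut X) :
    treeSection x (g * h) = treeSection (h x) g * treeSection x h := by
  ext1 w
  have e := apply_append_eq (g * h) x w
  simp only [RelIso.mul_apply] at e ⊢
  rw [apply_append_eq h, apply_append_eq g] at e
  exact (List.append_cancel_left e).symm

/-- `st(Y)`, the pointwise stabilizer in `Aut(X^*)` of a set `Y` of vertices; for
`H ≤ Aut(X^*)`, the subgroup `st_H(Y)` is `H ⊓ stab Y`. -/
def stab (Y : Set (List X)) : Subgroup (TreeAut X) where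
  carrier := {g | ∀ y ∈ Y, g y = y}
  one_mem' _ _ := rfl
  mul_mem' := by
    intro g h hg hh y hy
    rw [RelIso.mul_apply, hh y hy, hg y hy]
  inv_mem' := by
    intro g hg y hy
    conv_lhs => rw [← hg y hy]
    exact RelIso.inv_apply_self g y

/-- The level `X^n`. -/
def level (X : Type u) (n : ℕ) : Set (List X) := {w | w.length = n}

/-- The homomorphism `ψ_Y : st(Y) → Aut(X^*)^Y` given by the sections at the vertices of `Y`. -/
def psi (Y : Set (List X)) : stab Y →* (Y → TreeAut X) where
  toFun g y := treeSection y.1 g.1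
  map_one' := by
    funext y
    exact treeSection_one y.1
  map_mul' g h := by
    funext y
    have e := treeSection_mul y.1 g.1 h.1
    rw [h.2 y.1 y.2] at e
    exact e

/-- For a set `Y` of pairwise incomparable vertices, the group `K^Y` acting as a copy of `K` on each
subtree rooted at a vertex of `Y`, and trivially outside these subtrees. -/
def power (K : Subgroup (TreeAut X)) (Y : Set (List X)) : Subgroup (TreeAut X) where
  carrier := {g | (∀ y ∈ Y, g y = y ∧ treeSection y g ∈ K) ∧
    ∀ w, (∀ y ∈ Y, ¬ y <+: w) → g w = w}
  one_mem' :=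
    ⟨fun y _ => ⟨rfl, by rw [treeSection_one]; exact K.one_mem⟩, fun _ _ => rfl⟩
  mul_mem' := by
    rintro g h ⟨hg, hg'⟩ ⟨hh, hh'⟩
    refine ⟨fun y hy => ⟨?_, ?_⟩, fun w hw => ?_⟩
    · rw [RelIso.mul_apply, (hh y hy).1, (hg y hy).1]
    · rw [treeSection_mul, (hh y hy).1]
      exact K.mul_mem (hg y hy).2 (hh y hy).2
    · rw [RelIso.mul_apply, hh' w hw, hg' w hw]
  inv_mem' := by
    rintro g ⟨hg, hg'⟩
    refine ⟨fun y hy => ⟨?_, ?_⟩, fun w hw => ?_⟩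
    · conv_lhs => rw [← (hg y hy).1]
      exact RelIso.inv_apply_self g y
    · have e := treeSection_mul y g⁻¹ g
      rw [inv_mul_cancel, treeSection_one, (hg y hy).1] at e
      rw [eq_inv_of_mul_eq_one_left e.symm]
      exact K.inv_mem (hg y hy).2
    · conv_lhs => rw [← hg' w hw]
      exact RelIso.inv_apply_self g w

/-- A finite set `Y` of pairwise incomparable vertices such that every word of sufficiently
large length has a prefix in `Y`. -/
def IsSpanningLeafSet (Y : Finset (List X)) : Prop :=
  (∀ x ∈ Y, ∀ y ∈ Y, x <+: y → x = y) ∧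
    ∃ N : ℕ, ∀ w : List X, N ≤ w.length → ∃ y ∈ Y, y <+: w

def SelfSimilar (G : Subgroup (TreeAut X)) : Prop :=
  ∀ g ∈ G, ∀ x : List X, treeSection x g ∈ G

def LevelTransitive (G : Subgroup (TreeAut X)) : Prop :=
  ∀ u v : List X, u.length = v.length → ∃ g ∈ G, g u = v

/-- `G` is self-similar and `ψ_x(st_G(n)) = G` for all `n ≥ 1` and `x ∈ X^n`. -/
def StronglySelfReplicating (G : Subgroup (TreeAut X)) : Prop :=
  SelfSimilar G ∧ ∀ n : ℕ, 1 ≤ n → ∀ x ∈ level X n,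
    treeSection x '' ((G ⊓ stab (level X n) : Subgroup (TreeAut X)) : Set (TreeAut X)) = G

/-- `K` is a branching subgroup of `G`: a normal subgroup of finite index in `G` such that
`K^{x} ≤ K` for every vertex `x` and `K^{X^n}` has finite index in `G` for every `n`. -/
def IsBranchingSubgroup (K G : Subgroup (TreeAut X)) : Prop :=
  K ≤ G ∧ (K.subgroupOf G).Normal ∧ K.relIndex G ≠ 0 ∧
    (∀ x : List X, power K {x} ≤ K) ∧
    ∀ n : ℕ, power K (level X n) ≤ G ∧ (power K (level X n)).relIndex G ≠ 0

def RegularBranch (G : Subgroup (TreeAut X)) : Prop :=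
  SelfSimilar G ∧ LevelTransitive G ∧ ∃ K : Subgroup (TreeAut X), IsBranchingSubgroup K G

/-- `⋂ n, H st_G(n) = H` for every finitely generated `H ≤ G`. -/
def WellApproximatedSubgroups (G : Subgroup (TreeAut X)) : Prop :=
  ∀ H : Subgroup (TreeAut X), H ≤ G → H.FG →
    ⋂ n : ℕ, (H : Set (TreeAut X)) *
      ((G ⊓ stab (level X n) : Subgroup (TreeAut X)) : Set (TreeAut X)) = H

/-- The Grigorchuk--Nagnibeda alternative: for every finitely generated `H ≤ G`, either
`ψ_y(H) = {h_y : h ∈ H}` is finite for some vertex `y`, or there is a spanning leaf set `Y` such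
that (the image under `ψ_Y` of) `st_H(Y)` is an infra-direct product of `G^Y`. -/
def GrigorchukNagnibedaAlternative (G : Subgroup (TreeAut X)) : Prop :=
  ∀ H : Subgroup (TreeAut X), H ≤ G → H.FG →
    (∃ y : List X, (treeSection y '' (H : Set (TreeAut X))).Finite) ∨
    ∃ Y : Finset (List X), IsSpanningLeafSet Y ∧
      IsInfraDirect G ((H.subgroupOf (stab (Y : Set (List X)))).map (psi (Y : Set (List X))))

end Trees

end BranchSub

/-!
A subgroup `L` outside the perfect kernel is finitely generated, and its Cantor--Bendixson rank is
its depth, because `L` contains a finitely generated `H` such that `st_H(Y)` is an infra-direct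
product of `G^Y`, and the overgroups of such an `H` are very restricted.

*Finding `H`.* Every subgroup is a limit of its finitely generated subgroups, and the perfect kernel
is closed, so some finitely generated `H ≤ L` is outside the kernel. If `H` had finitely many
sections at a vertex, its orbits on the subtree below that vertex would be bounded, so at a deep
level one could adjoin an element supported away from the orbit of some vertex `v` without changing
the sections at `v` (`exists_adjoin_finite_sections`). As finitely generated subgroups are
well approximated, this exhibits `H` as a limit of subgroups of the same kind, which therefore form
a set without isolated points (`mem_perfectKernel_of_finite_sections`). The Grigorchuk--Nagnibeda
alternative leaves only the infra-direct case.

*Overgroups of `H`.* For `H ≤ M ≤ G`, the coordinates of `st_M(Y)` (with any set of other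
coordinates required to be trivial) are subgroups `D` of `G` normalized by a finite index subgroup
`Q` of `G`. If such a `D` moves a vertex `v`, a commutator argument and just infiniteness show that
`D` contains a finite index part of the copy of `G` at `v`
(`relIndex_comap_graft_ne_zero_of_moves`). Since `Q` has
boundedly many orbits on each level, at all deep levels every vertex is either moved by `D` or the
root of a subtree fixed by `D` (`eventually_resolves`). So up to finite index `D` is determined by a
`Q`-invariant set of vertices of one level, which gives two facts about every `M ≥ H`: chains of
infinite index inclusions above `M` have bounded length
(`ContainsInfraDirect.exists_chain_bound`), and `M` has finite index in its commensurator
(`ContainsInfraDirect.relIndex_ne_zero_of_commensurates`), because finite index subgroups of `G`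
have trivial centralizer (`eq_one_of_commute`).

*Rank and depth.* These two facts imply that every `M ≥ H` is finitely generated
(`HasBoundedOvergroups.fg`). If `M` has infinite index in `P`, then `M` is the limit of the finite
index subgroups `P ∩ M st_G(k)` of `P`, so the rank is at least the depth. Conversely, near `M`
there are only overgroups of `M`, and, after removing the finitely many that have finite index over
`M`, only those of smaller depth remain besides `M`, so the rank is at most the depth.
-/

open scoped commutatorElement

namespace BranchSub

/-! ### Indices of subgroups -/

section Index

variable {A B : Type*} [Group A] [Group B]

theorem relIndex_ne_zero_of_map_of_ker (f : A →* B) {P Q : Subgroup A} (hPQ : P ≤ Q)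
    (hmap : (P.map f).relIndex (Q.map f) ≠ 0) (hker : (P ⊓ f.ker).relIndex (Q ⊓ f.ker) ≠ 0) :
    P.relIndex Q ≠ 0 := by
  rw [Subgroup.relIndex_map_map] at hmap
  have h1 : (P ⊔ f.ker).relIndex Q ≠ 0 := fun h =>
    hmap (Subgroup.relIndex_eq_zero_of_le_right le_sup_left h)
  have h2 : P.relIndex (Q ⊓ (P ⊔ f.ker)) ≠ 0 := by
    have hN : Q ⊓ f.ker ≤ Q ⊓ (P ⊔ f.ker) := inf_le_inf_left _ le_sup_right
    have hfin : Finite (↥(Q ⊓ f.ker) ⧸ P.subgroupOf (Q ⊓ f.ker)) :=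
      Nat.finite_of_card_ne_zero fun h =>
        hker (Subgroup.relIndex_eq_zero_of_le_left inf_le_left h)
    have hsurj : Function.Surjective (Subgroup.quotientSubgroupOfEmbeddingOfLE P hN) := by
      intro q
      induction q using QuotientGroup.induction_on with
      | H z =>
        obtain ⟨z, hz⟩ := z
        obtain ⟨hzQ, hz'⟩ := id hz
        -- write `z = (z x⁻¹) x` with `x ∈ P` and `z x⁻¹` in the kernel
        obtain ⟨k, hk, x, hx, rfl⟩ := Subgroup.mem_sup_of_normal_left.mp (sup_comm P f.ker ▸ hz')
        have hkQ : k ∈ Q := by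
          have := Q.mul_mem hzQ (Q.inv_mem (hPQ hx))
          simpa using this
        refine ⟨QuotientGroup.mk ⟨k, hkQ, hk⟩, ?_⟩
        rw [Subgroup.quotientSubgroupOfEmbeddingOfLE_apply_mk, QuotientGroup.eq]
        simpa [Subgroup.mem_subgroupOf] using hx
    have := Finite.of_surjective _ hsurj
    exact Nat.card_ne_zero.mpr ⟨⟨QuotientGroup.mk 1⟩, this⟩
  intro h
  rw [← Subgroup.inf_relIndex_right] at h1
  have h3 := Subgroup.relIndex_mul_relIndex P (Q ⊓ (P ⊔ f.ker)) Q (le_inf hPQ le_sup_left)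
    inf_le_left
  rw [h, inf_comm] at h3
  rw [inf_comm] at h2
  exact mul_ne_zero h2 h1 h3

/-- A subgroup normalized by `Q`, phrased elementwise. -/
def NormalizedBy (D Q : Subgroup A) : Prop := ∀ q ∈ Q, ∀ d ∈ D, q * d * q⁻¹ ∈ D

end Index

/-! ### Automorphisms of the tree -/

section Tree

variable {X : Type u}

theorem apply_prefix (g : TreeAut X) {u w : List X} : g u <+: g w ↔ u <+: w := g.map_rel_iff

theorem apply_inv_apply (g : TreeAut X) (w : List X) : g (g⁻¹ w) = w := g.apply_symm_apply w

theorem inv_apply_apply (g : TreeAut X) (w : List X) : g⁻¹ (g w) = w := g.symm_apply_apply w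

theorem length_le_length_apply (g : TreeAut X) (w : List X) : w.length ≤ (g w).length := by
  induction w using List.reverseRecOn with
  | nil => simp
  | append_singleton w a ih =>
    have h1 : g w <+: g (w ++ [a]) := (apply_prefix g).mpr (List.prefix_append _ _)
    have h2 : (g w).length ≠ (g (w ++ [a])).length := fun h => by
      have := g.injective (h1.eq_of_length h)
      simp at this
    have h3 := h1.length_le
    simp only [List.length_append, List.length_singleton]
    omega

@[simp]
theorem length_apply (g : TreeAut X) (w : List X) : (g w).length = w.length := by
  apply le_antisymm _ (length_le_length_apply g w)
  conv_rhs => rw [← inv_apply_apply g w]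
  exact length_le_length_apply g⁻¹ (g w)

theorem eq_of_prefix_of_prefix {u v w : List X} (hl : u.length = v.length) (hu : u <+: w)
    (hv : v <+: w) : u = v :=
  (List.prefix_of_prefix_length_le hu hv hl.le).eq_of_length hl

theorem apply_eq_of_prefix {g : TreeAut X} {u w : List X} (h : u <+: w) (hw : g w = w) :
    g u = u :=
  eq_of_prefix_of_prefix (length_apply g u) (hw ▸ (apply_prefix g).mpr h) h

theorem treeSection_append (x y : List X) (g : TreeAut X) :
    treeSection (x ++ y) g = treeSection y (treeSection x g) := by
  ext1 w
  have h1 := apply_append_eq g (x ++ y) w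
  have h2 := apply_append_eq g x (y ++ w)
  rw [apply_append_eq g x y] at h1
  rw [apply_append_eq (treeSection x g) y w] at h2
  rw [List.append_assoc, h2, List.append_assoc] at h1
  exact (List.append_cancel_left (List.append_cancel_left h1)).symm

theorem treeSection_eq_one_iff {x : List X} {g : TreeAut X} (hx : g x = x) :
    treeSection x g = 1 ↔ ∀ w, g (x ++ w) = x ++ w := by
  constructor
  · intro h w
    rw [apply_append_eq, h, hx]
    rfl
  · intro h
    ext1 w
    have := h w
    rw [apply_append_eq, hx] at this
    exact List.append_cancel_left this

open Classical in
/-- The automorphism acting as `g` on the subtree rooted at `v`, and trivially elsewhere; this is a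
homomorphism in `g`. -/
noncomputable def graft (v : List X) : TreeAut X →* TreeAut X where
  toFun g :=
    { toFun := fun w => if v <+: w then v ++ g (w.drop v.length) else w
      invFun := fun w => if v <+: w then v ++ g⁻¹ (w.drop v.length) else w
      left_inv := by
        intro w
        by_cases h : v <+: w
        · obtain ⟨t, rfl⟩ := h
          simp
        · simp [h]
      right_inv := by
        intro w
        by_cases h : v <+: w
        · obtain ⟨t, rfl⟩ := h
          simp
        · simp [h]
      map_rel_iff' := by
        intro a b
        simp only [Equiv.coe_fn_mk]
        by_cases ha : v <+: a
        · obtain ⟨a, rfl⟩ := ha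
          by_cases hb : v <+: b
          · obtain ⟨b, rfl⟩ := hb
            simp [List.prefix_append_right_inj, apply_prefix]
          · simp only [List.prefix_append, if_true, hb, if_false]
            exact ⟨fun h => absurd ((List.prefix_append _ _).trans h) hb,
              fun h => absurd ((List.prefix_append _ _).trans h) hb⟩
        · by_cases hb : v <+: b
          · obtain ⟨b, rfl⟩ := hb
            simp only [List.prefix_append, if_true, ha, if_false]
            have key : ∀ c : List X, a <+: v ++ c ↔ a <+: v := fun c =>
              ⟨fun h =>
                (List.prefix_or_prefix_of_prefix h (List.prefix_append v c)).resolve_right ha,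
                fun h => h.trans (List.prefix_append v c)⟩
            rw [key, key]
          · simp [ha, hb] }
  map_one' := by
    ext1 w
    change (if v <+: w then _ else w) = w
    split_ifs with h
    · obtain ⟨t, rfl⟩ := h
      simp
    · rfl
  map_mul' g h := by
    ext1 w
    rw [RelIso.mul_apply]
    change (if v <+: w then _ else w) = if v <+: (if v <+: w then _ else w) then _ else _
    by_cases hw : v <+: w
    · obtain ⟨t, rfl⟩ := hw
      simp
    · simp [hw]

open Classical in
theorem graft_apply_append (v : List X) (g : TreeAut X) (w : List X) :
    graft v g (v ++ w) = v ++ g w := by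
  change (if v <+: v ++ w then _ else _) = _
  simp

open Classical in
theorem graft_apply_of_not_prefix {v w : List X} (g : TreeAut X) (h : ¬ v <+: w) :
    graft v g w = w := by
  change (if v <+: w then _ else _) = _
  simp [h]

theorem graft_apply_self (v : List X) (g : TreeAut X) : graft v g v = v := by
  by_contra hne
  have h := graft_apply_append v g []
  have h0 : g [] = [] := List.length_eq_zero_iff.mp (by simp)
  rw [h0, List.append_nil] at h
  exact hne h

theorem treeSection_graft (v : List X) (g : TreeAut X) : treeSection v (graft v g) = g := by
  ext1 w
  have h := apply_append_eq (graft v g) v w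
  rw [graft_apply_append, graft_apply_self] at h
  exact (List.append_cancel_left h).symm

theorem graft_injective (v : List X) : Function.Injective (graft v) :=
  Function.LeftInverse.injective (treeSection_graft v)

theorem graft_mem_power {K : Subgroup (TreeAut X)} (v : List X) {g : TreeAut X} (hg : g ∈ K) :
    graft v g ∈ power K {v} := by
  refine ⟨?_, fun w hw => graft_apply_of_not_prefix g (hw v rfl)⟩
  rintro y rfl
  exact ⟨graft_apply_self y g, by rwa [treeSection_graft]⟩

/-- The rigid stabilizer of a vertex in the full automorphism group. -/
abbrev rist (v : List X) : Subgroup (TreeAut X) := power ⊤ {v}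

theorem mem_rist {v : List X} {g : TreeAut X} :
    g ∈ rist v ↔ ∀ w, ¬ v <+: w → g w = w := by
  constructor
  · intro h w hw
    exact h.2 w (by rintro y rfl; exact hw)
  · intro h
    refine ⟨?_, fun w hw => h w (hw v rfl)⟩
    rintro y rfl
    refine ⟨?_, trivial⟩
    -- the only vertex of this length that can be moved is `y` itself
    by_contra hne
    have h2 : ¬ y <+: g y := fun hp => hne (hp.eq_of_length (by simp)).symm
    exact hne (g.injective (h _ h2))

theorem graft_mem_rist (v : List X) (g : TreeAut X) : graft v g ∈ rist v :=
  graft_mem_power v (Subgroup.mem_top g)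

theorem rist_apply_self {v : List X} {g : TreeAut X} (h : g ∈ rist v) : g v = v := (h.1 v rfl).1

theorem conj_mem_rist {v : List X} {g : TreeAut X} (d : TreeAut X) (h : g ∈ rist v) :
    d * g * d⁻¹ ∈ rist (d v) := by
  rw [mem_rist] at h ⊢
  intro w hw
  have hw' : ¬ v <+: d⁻¹ w := by
    rwa [← apply_prefix d, apply_inv_apply]
  simp only [RelIso.mul_apply, h _ hw', apply_inv_apply]

theorem commute_of_mem_rist {u v : List X} (hl : u.length = v.length) (hne : u ≠ v)
    {a b : TreeAut X} (ha : a ∈ rist u) (hb : b ∈ rist v) : Commute a b := by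
  have key : ∀ {u v : List X}, u.length = v.length → u ≠ v → ∀ {a b : TreeAut X}, a ∈ rist u →
      b ∈ rist v → ∀ w, u <+: w → a (b w) = b (a w) := by
    intro u v hl hne a b ha hb w hw
    have h1 : ¬ v <+: w := fun h => hne (eq_of_prefix_of_prefix hl hw h)
    have h2 : ¬ v <+: a w := fun h => hne (eq_of_prefix_of_prefix hl (by
      rw [← rist_apply_self ha]; exact (apply_prefix a).mpr hw) h)
    rw [mem_rist.mp hb _ h1, mem_rist.mp hb _ h2]
  ext1 w
  simp only [RelIso.mul_apply]
  by_cases hu : u <+: w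
  · exact key hl hne ha hb w hu
  by_cases hv : v <+: w
  · exact (key hl.symm hne.symm hb ha w hv).symm
  rw [mem_rist.mp ha w hu, mem_rist.mp hb w hv, mem_rist.mp ha w hu]

theorem eq_one_of_mem_rist_of_mem_rist {u v : List X} (hl : u.length = v.length) (hne : u ≠ v)
    {a : TreeAut X} (ha : a ∈ rist u) (hb : a ∈ rist v) : a = 1 := by
  ext1 w
  by_cases hu : u <+: w
  · exact mem_rist.mp hb w fun hv => hne (eq_of_prefix_of_prefix hl hu hv)
  · exact mem_rist.mp ha w hu

theorem finite_level [Finite X] (n : ℕ) : (level X n).Finite := List.finite_length_eq X n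

theorem ncard_level [Finite X] (n : ℕ) : (level X n).ncard = Nat.card X ^ n := by
  have := Fintype.ofFinite X
  have h : (level X n).ncard = Nat.card (List.Vector X n) := rfl
  rw [h, Nat.card_eq_fintype_card, card_vector, Nat.card_eq_fintype_card]

theorem index_stabilizer_ne_zero [Finite X] (v : List X) :
    (MulAction.stabilizer (TreeAut X) v).index ≠ 0 := by
  have hf : (MulAction.orbit (TreeAut X) v).Finite := by
    refine (finite_level v.length).subset ?_
    rintro _ ⟨g, rfl⟩
    exact length_apply g v
  rw [MulAction.index_stabilizer]
  exact ((Set.ncard_pos hf).mpr ⟨v, MulAction.mem_orbit_self v⟩).ne'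

theorem index_stab_ne_zero [Finite X] {Y : Set (List X)} (hY : Y.Finite) : (stab Y).index ≠ 0 := by
  have := hY.to_subtype
  have e : stab Y = ⨅ y : Y, MulAction.stabilizer (TreeAut X) (y : List X) := by
    ext g
    simp only [Subgroup.mem_iInf, MulAction.mem_stabilizer_iff, Subtype.forall]
    rfl
  rw [e]
  exact Subgroup.index_iInf_ne_zero fun y => index_stabilizer_ne_zero _

theorem relIndex_stab_ne_zero [Finite X] {Y : Set (List X)} (hY : Y.Finite)
    (H : Subgroup (TreeAut X)) : (stab Y).relIndex H ≠ 0 := fun h =>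
  index_stab_ne_zero hY (Subgroup.index_eq_zero_of_relIndex_eq_zero h)

end Tree

/-! ### Finite index subgroups of a branch group -/

section Branch

variable {X : Type u} {G K : Subgroup (TreeAut X)}

theorem graft_mem_of_mem (hK : IsBranchingSubgroup K G) (v : List X) {k : TreeAut X} (hk : k ∈ K) :
    graft v k ∈ K :=
  hK.2.2.2.1 v (graft_mem_power v hk)

theorem infinite_of_relIndex_ne_zero {A : Type*} [Group A] {P Q : Subgroup A} [Infinite Q]
    (hPQ : P ≤ Q) (h : P.relIndex Q ≠ 0) : Infinite P := by
  rw [← not_finite_iff_infinite]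
  intro hfin
  have h1 := Subgroup.relIndex_mul_relIndex ⊥ P Q bot_le hPQ
  rw [Subgroup.relIndex_bot_left, Subgroup.relIndex_bot_left, Nat.card_eq_zero_of_infinite (α := Q)]
    at h1
  exact mul_ne_zero Nat.card_pos.ne' h h1

theorem exists_mem_ne_one_of_relIndex_ne_zero {A : Type*} [Group A] {P Q : Subgroup A} [Infinite Q]
    (h : P.relIndex Q ≠ 0) : ∃ b ∈ P, b ∈ Q ∧ b ≠ 1 := by
  rw [← Subgroup.inf_relIndex_right] at h
  have := infinite_of_relIndex_ne_zero inf_le_right h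
  obtain ⟨b, hb⟩ := exists_ne (1 : ↥(P ⊓ Q))
  exact ⟨b, b.2.1, b.2.2, fun h => hb (Subtype.ext h)⟩

theorem relIndex_comap_graft_ne_zero (hK : IsBranchingSubgroup K G) (v : List X)
    {F : Subgroup (TreeAut X)} (hF : F.relIndex G ≠ 0) :
    (F.comap (graft v)).relIndex K ≠ 0 := by
  rw [Subgroup.relIndex_comap]
  refine fun h => hF (Subgroup.relIndex_eq_zero_of_le_right ?_ h)
  rintro _ ⟨k, hk, rfl⟩
  exact hK.1 (graft_mem_of_mem hK v hk)

theorem relIndex_comap_graft_inf_ne_zero (hK : IsBranchingSubgroup K G) (v : List X)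
    {F : Subgroup (TreeAut X)} (hF : F.relIndex G ≠ 0) :
    (F.comap (graft v) ⊓ K).relIndex G ≠ 0 := by
  refine Subgroup.relIndex_ne_zero_trans ?_ hK.2.2.1
  rw [Subgroup.inf_relIndex_right]
  exact relIndex_comap_graft_ne_zero hK v hF

/-- Finite index subgroups of a branch group have trivial centralizer: if `k` moves `u`, then `k`
conjugates any nontrivial element supported below `u` to one supported elsewhere. -/
theorem eq_one_of_commute [Infinite G] (hK : IsBranchingSubgroup K G)
    {F : Subgroup (TreeAut X)} (hF : F.relIndex G ≠ 0) {k : TreeAut X}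
    (h : ∀ b ∈ F, Commute k b) : k = 1 := by
  have := infinite_of_relIndex_ne_zero hK.1 hK.2.2.1
  ext1 u
  by_contra hu
  obtain ⟨b, hbF, -, hb1⟩ :=
    exists_mem_ne_one_of_relIndex_ne_zero (relIndex_comap_graft_ne_zero hK u hF)
  have h1 : graft u b ∈ rist (k u) := by
    have h2 := conj_mem_rist k (graft_mem_rist u b)
    rwa [(h _ hbF).eq, mul_inv_cancel_right] at h2
  have h2 := eq_one_of_mem_rist_of_mem_rist (by simp) hu h1 (graft_mem_rist u b)
  exact hb1 (graft_injective u (h2.trans (map_one _).symm))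

theorem relIndex_map_subtype {A : Type*} [Group A] (G : Subgroup A) (S : Subgroup G) :
    (S.map G.subtype).relIndex G = S.index := by
  rw [Subgroup.relIndex]
  congr 1
  exact Subgroup.comap_map_eq_self_of_injective G.subtype_injective S

theorem relIndex_commutator_ne_zero (hG : JustInfinite G) (hK : IsBranchingSubgroup K G)
    {F : Subgroup (TreeAut X)} (hF : F.relIndex G ≠ 0) : ⁅F, F⁆.relIndex G ≠ 0 := by
  have := hG.1
  have hfi : (F.subgroupOf G).FiniteIndex := ⟨hF⟩
  set N := (F.subgroupOf G).normalCore with hN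
  have hNi : N.index ≠ 0 := Subgroup.FiniteIndex.index_ne_zero
  have hNle : N.map G.subtype ≤ F := by
    rintro _ ⟨x, hx, rfl⟩
    exact Subgroup.normalCore_le (F.subgroupOf G) hx
  have hne : ⁅N, N⁆ ≠ ⊥ := by
    intro hbot
    have hNr : (N.map G.subtype).relIndex G ≠ 0 := by rwa [relIndex_map_subtype]
    obtain ⟨k, hk, -, hk1⟩ := exists_mem_ne_one_of_relIndex_ne_zero hNr
    refine hk1 (eq_one_of_commute hK hNr fun b hb => ?_)
    obtain ⟨k, hk, rfl⟩ := hk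
    obtain ⟨b, hb, rfl⟩ := hb
    have h1 : ⁅k, b⁆ = 1 := by
      rw [← Subgroup.mem_bot, ← hbot]
      exact Subgroup.commutator_mem_commutator hk hb
    exact Commute.map (commutatorElement_eq_one_iff_commute.mp h1) G.subtype
  have hfin := hG.2 ⁅N, N⁆ inferInstance hne
  have h1 : (⁅N, N⁆.map G.subtype).relIndex G ≠ 0 := by
    rw [relIndex_map_subtype]
    exact Nat.card_ne_zero.mpr ⟨⟨QuotientGroup.mk 1⟩, hfin⟩
  refine fun h => h1 (Subgroup.relIndex_eq_zero_of_le_left ?_ h)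
  rw [Subgroup.map_commutator]
  exact Subgroup.commutator_mono hNle hNle

/-! ### Subgroups normalized by a finite index subgroup -/

theorem commutator_mem_of_moves {D Q : Subgroup (TreeAut X)} (hDQ : NormalizedBy D Q) {v : List X}
    {d a b : TreeAut X} (hd : d ∈ D) (hdv : d v ≠ v) (ha : a ∈ Q) (hav : a ∈ rist v) (hb : b ∈ Q)
    (hbv : b ∈ rist v) : ⁅a, b⁆ ∈ D := by
  -- `a` agrees with `⁅a, d⁆ ∈ D` up to a factor supported below `d v`, which commutes with `b`
  have hc : Commute (d * a⁻¹ * d⁻¹) b :=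
    commute_of_mem_rist (by simp) hdv (conj_mem_rist d (inv_mem hav)) hbv
  have hx : ⁅a, d⁆ ∈ D := D.mul_mem (hDQ a ha d hd) (D.inv_mem hd)
  have hy : ⁅⁅a, d⁆, b⁆ ∈ D := by
    have := D.mul_mem hx (hDQ b hb _ (D.inv_mem hx))
    simpa only [commutatorElement_def, mul_assoc] using this
  have e : ⁅a, d⁆ = a * (d * a⁻¹ * d⁻¹) := by
    simp only [commutatorElement_def, mul_assoc]
  have e2 : ⁅⁅a, d⁆, b⁆ = ⁅a, b⁆ := by
    rw [e]
    generalize d * a⁻¹ * d⁻¹ = c at hc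
    rw [commutatorElement_def, commutatorElement_def, mul_inv_rev, mul_assoc a c b, hc.eq]
    group
  rwa [e2] at hy

/-- A subgroup normalized by a finite index subgroup of `G` contains a finite index part of the copy
of `G` at every vertex that it moves. -/
theorem relIndex_comap_graft_ne_zero_of_moves (hG : JustInfinite G) (hK : IsBranchingSubgroup K G)
    {D Q : Subgroup (TreeAut X)} (hDQ : NormalizedBy D Q) (hQ : Q.relIndex G ≠ 0) {v : List X}
    (hv : ∃ d ∈ D, d v ≠ v) : (D.comap (graft v)).relIndex G ≠ 0 := by
  obtain ⟨d, hd, hdv⟩ := hv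
  have hF := relIndex_comap_graft_inf_ne_zero hK v hQ
  refine fun h => relIndex_commutator_ne_zero hG hK hF
    (Subgroup.relIndex_eq_zero_of_le_left ?_ h)
  rw [Subgroup.commutator_le]
  intro a ha b hb
  rw [Subgroup.mem_comap, map_commutatorElement]
  exact commutator_mem_of_moves hDQ hd hdv ha.1 (graft_mem_rist v a) hb.1 (graft_mem_rist v b)

/-- The vertices of level `m` that are moved by `D`. -/
def moved (D : Subgroup (TreeAut X)) (m : ℕ) : Set (List X) :=
  {v | v.length = m ∧ ∃ d ∈ D, d v ≠ v}

/-- Every vertex of level `m` either is moved by `D`, or is the root of a subtree on which `D` acts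
trivially. -/
def Resolves (D : Subgroup (TreeAut X)) (m : ℕ) : Prop :=
  ∀ v : List X, v.length = m → v ∉ moved D m → ∀ d ∈ D, ∀ w, d (v ++ w) = v ++ w

theorem moved_mono {D D' : Subgroup (TreeAut X)} (h : D ≤ D') (m : ℕ) : moved D m ⊆ moved D' m :=
  fun _ ⟨hv, d, hd, hdv⟩ => ⟨hv, d, h hd, hdv⟩

theorem moved_subset_level (D : Subgroup (TreeAut X)) (m : ℕ) : moved D m ⊆ level X m :=
  fun _ h => h.1

theorem apply_eq_of_notMem_moved {D : Subgroup (TreeAut X)} {v : List X} {m : ℕ}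
    (hv : v.length = m) (h : v ∉ moved D m) {d : TreeAut X} (hd : d ∈ D) : d v = v := by
  by_contra hne
  exact h ⟨hv, d, hd, hne⟩

theorem apply_mem_moved {D Q : Subgroup (TreeAut X)} (hDQ : NormalizedBy D Q) {m : ℕ}
    {q : TreeAut X} (hq : q ∈ Q) {v : List X} (hv : v ∈ moved D m) : q v ∈ moved D m := by
  obtain ⟨hl, d, hd, hdv⟩ := hv
  refine ⟨by rw [length_apply, hl], _, hDQ q hq d hd, ?_⟩
  rw [RelIso.mul_apply, RelIso.mul_apply, inv_apply_apply]
  exact fun h => hdv (q.injective h)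

theorem Resolves.of_le {D : Subgroup (TreeAut X)} {m n : ℕ} (h : Resolves D m) (hmn : m ≤ n) :
    Resolves D n := by
  intro v hv hvn d hd w
  have hl : (v.take m).length = m := by simp [hv, hmn]
  have hm : v.take m ∉ moved D m := by
    rintro ⟨-, e, he, hne⟩
    exact hne (apply_eq_of_prefix (List.take_prefix m v) (apply_eq_of_notMem_moved hv hvn he))
  have := h _ hl hm d hd (v.drop m ++ w)
  rwa [← List.append_assoc, List.take_append_drop] at this

theorem relIndex_stabilizer_eq (H : Subgroup (TreeAut X)) (v : List X) :
    (MulAction.stabilizer (TreeAut X) v).relIndex H = (MulAction.orbit H v).ncard := by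
  rw [← MulAction.index_stabilizer, Subgroup.relIndex]
  rfl

/-- By level transitivity, a nonempty set of vertices of level `m` that is invariant under a
subgroup of index `c` makes up at least the proportion `1 / c` of the level. -/
theorem card_pow_le_of_invariant [Finite X] (ht : LevelTransitive G) {Q : Subgroup (TreeAut X)}
    (hQ : Q.relIndex G ≠ 0) {m : ℕ} {W : Set (List X)} (hW : W ⊆ level X m) (hne : W.Nonempty)
    (hinv : ∀ q ∈ Q, ∀ w ∈ W, q w ∈ W) :
    Nat.card X ^ m ≤ Q.relIndex G * W.ncard := by
  obtain ⟨w, hw⟩ := hne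
  set s := MulAction.stabilizer (TreeAut X) w
  have hs : s.index ≠ 0 := index_stabilizer_ne_zero w
  have hs' : ∀ H, s.relIndex H ≠ 0 := fun H h =>
    hs (Subgroup.index_eq_zero_of_relIndex_eq_zero h)
  have h1 : s.relIndex G = Nat.card X ^ m := by
    rw [relIndex_stabilizer_eq, ← ncard_level]
    congr 1
    ext v
    constructor
    · rintro ⟨g, rfl⟩
      exact (length_apply _ _).trans (hW hw)
    · intro hv
      obtain ⟨g, hg, hgv⟩ := ht w v ((hW hw).trans hv.symm)
      exact ⟨⟨g, hg⟩, hgv⟩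
  have h2 : s.relIndex Q ≤ W.ncard := by
    rw [relIndex_stabilizer_eq]
    refine Set.ncard_le_ncard ?_ ((finite_level m).subset hW)
    rintro _ ⟨q, rfl⟩
    exact hinv q q.2 w hw
  calc Nat.card X ^ m = s.relIndex G := h1.symm
    _ ≤ (s ⊓ Q).relIndex G :=
      Subgroup.relIndex_le_of_le_left inf_le_left (Subgroup.relIndex_inf_ne_zero (hs' G) hQ)
    _ = s.relIndex (Q ⊓ G) * Q.relIndex G := (Subgroup.relIndex_inf_mul_relIndex s Q G).symm
    _ ≤ s.relIndex Q * Q.relIndex G :=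
      Nat.mul_le_mul_right _ (Subgroup.relIndex_le_of_le_right inf_le_left (hs' Q))
    _ ≤ Q.relIndex G * W.ncard := by
      rw [mul_comm]
      exact Nat.mul_le_mul_left _ h2

theorem exists_density_increment [Finite X] (ht : LevelTransitive G) {D Q : Subgroup (TreeAut X)}
    (hDQ : NormalizedBy D Q) (hQ : Q.relIndex G ≠ 0) {m : ℕ} (hm : ¬ Resolves D m) :
    ∃ n, Q.relIndex G * (moved D m).ncard * Nat.card X ^ n + Nat.card X ^ (m + n) ≤
      Q.relIndex G * (moved D (m + n)).ncard := by
  simp only [Resolves, not_forall] at hm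
  obtain ⟨v, hv, hvm, d, hd, w, hne⟩ := hm
  refine ⟨w.length, ?_⟩
  set n := w.length
  -- the vertices of level `m + n` below moved vertices of level `m`, and the other moved ones
  set A : Set (List X) := (fun p : List X × List X => p.1 ++ p.2) '' (moved D m ×ˢ level X n)
  set B : Set (List X) := {u | u ∈ moved D (m + n) ∧ u.take m ∉ moved D m}
  have hA : A.ncard = (moved D m).ncard * Nat.card X ^ n := by
    rw [Set.InjOn.ncard_image, Set.ncard_prod, ncard_level]
    rintro ⟨a, b⟩ ⟨ha, -⟩ ⟨a', b'⟩ ⟨ha', -⟩ h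
    obtain ⟨h1, h2⟩ := List.append_inj h (ha.1.trans ha'.1.symm)
    exact Prod.ext h1 h2
  have hAsub : A ⊆ moved D (m + n) := by
    rintro _ ⟨⟨a, b⟩, ⟨⟨ha, e, he, hea⟩, hb⟩, rfl⟩
    refine ⟨?_, e, he, fun h => hea (apply_eq_of_prefix (List.prefix_append a b) h)⟩
    have hb' : b.length = n := hb
    simp [ha, hb']
  have hBsub : B ⊆ moved D (m + n) := fun _ h => h.1
  have hdisj : Disjoint A B := by
    rw [Set.disjoint_left]
    rintro _ ⟨⟨a, b⟩, ⟨ha, hb⟩, rfl⟩ ⟨-, h⟩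
    apply h
    simpa [← ha.1] using ha
  have hBne : B.Nonempty := by
    refine ⟨v ++ w, ⟨by simp [hv, n], d, hd, hne⟩, ?_⟩
    simpa [← hv] using hvm
  have hBinv : ∀ q ∈ Q, ∀ u ∈ B, q u ∈ B := by
    rintro q hq u ⟨hu, hum⟩
    refine ⟨apply_mem_moved hDQ hq hu, fun h => hum ?_⟩
    have h1 := apply_mem_moved hDQ (Q.inv_mem hq) h
    have hl : u.length = m + n := hu.1
    have h2 : q⁻¹ ((q u).take m) = u.take m := by
      apply eq_of_prefix_of_prefix (w := u)
      · simp
      · conv_rhs => rw [← inv_apply_apply q u]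
        exact (apply_prefix _).mpr (List.take_prefix _ _)
      · exact List.take_prefix _ _
    rwa [h2] at h1
  have hfin : (moved D (m + n)).Finite := (finite_level _).subset (moved_subset_level D _)
  have hB := card_pow_le_of_invariant ht hQ (hBsub.trans (moved_subset_level D _)) hBne hBinv
  have hAB : A.ncard + B.ncard ≤ (moved D (m + n)).ncard := by
    rw [← Set.ncard_union_eq hdisj (hfin.subset hAsub) (hfin.subset hBsub)]
    exact Set.ncard_le_ncard (Set.union_subset hAsub hBsub) hfin
  calc _ ≤ Q.relIndex G * A.ncard + Q.relIndex G * B.ncard := by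
        rw [hA, mul_assoc]
        exact Nat.add_le_add_left hB _
    _ ≤ _ := by
        rw [← Nat.mul_add]
        exact Nat.mul_le_mul_left _ hAB

/-- The action of a subgroup normalized by a finite index subgroup of `G` is resolved at all deep
levels: as long as it is not, passing to a deeper level increases the proportion of moved vertices
by a fixed amount. -/
theorem eventually_resolves [Finite X] [Nonempty X] (ht : LevelTransitive G)
    {D Q : Subgroup (TreeAut X)} (hDQ : NormalizedBy D Q) (hQ : Q.relIndex G ≠ 0) :
    ∀ᶠ m in Filter.atTop, Resolves D m := by
  suffices h : ∃ m, Resolves D m by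
    obtain ⟨m, hm⟩ := h
    filter_upwards [Filter.eventually_ge_atTop m] with n hn using hm.of_le hn
  by_contra! hcon
  have key : ∀ k, ∃ m, k * Nat.card X ^ m ≤ Q.relIndex G * (moved D m).ncard := by
    intro k
    induction k with
    | zero => exact ⟨0, by simp⟩
    | succ k ih =>
      obtain ⟨m, hm⟩ := ih
      obtain ⟨n, hn⟩ := exists_density_increment ht hDQ hQ (hcon m)
      refine ⟨m + n, le_trans ?_ hn⟩
      rw [add_mul, one_mul, pow_add, ← mul_assoc]
      exact Nat.add_le_add_right (Nat.mul_le_mul_right _ hm) _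
  obtain ⟨m, hm⟩ := key (Q.relIndex G + 1)
  have h1 : (moved D m).ncard ≤ Nat.card X ^ m := by
    rw [← ncard_level]
    exact Set.ncard_le_ncard (moved_subset_level D m) (finite_level m)
  have h2 : 0 < Nat.card X ^ m := pow_pos Nat.card_pos m
  have h3 := hm.trans (Nat.mul_le_mul_left _ h1)
  rw [add_mul] at h3
  omega

end Branch

/-! ### Coordinates of subgroups of a finite power -/

section Coordinates

variable {ι A : Type*} [Group A]

/-- The `j`-th coordinates of the elements of `P` whose coordinates in `s` are trivial. -/
def coord (P : Subgroup (ι → A)) (s : Finset ι) (j : ι) : Subgroup A :=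
  (P ⊓ Subgroup.pi (s : Set ι) fun _ => ⊥).map (Pi.evalMonoidHom (fun _ => A) j)

theorem mem_coord {P : Subgroup (ι → A)} {s : Finset ι} {j : ι} {a : A} :
    a ∈ coord P s j ↔ ∃ f ∈ P, (∀ i ∈ s, f i = 1) ∧ f j = a := by
  simp [coord, Subgroup.mem_pi, and_assoc]

theorem coord_mono {P P' : Subgroup (ι → A)} (h : P ≤ P') (s : Finset ι) (j : ι) :
    coord P s j ≤ coord P' s j :=
  Subgroup.map_mono (inf_le_inf_right _ h)

theorem coord_empty (P : Subgroup (ι → A)) (j : ι) :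
    coord P ∅ j = P.map (Pi.evalMonoidHom (fun _ => A) j) := by
  ext a
  simp [mem_coord]

theorem normalizedBy_coord {P P' : Subgroup (ι → A)} (h : P ≤ P') (s : Finset ι) (j : ι) :
    NormalizedBy (coord P' s j) (coord P ∅ j) := by
  intro q hq d hd
  obtain ⟨f, hf, -, rfl⟩ := mem_coord.mp hq
  obtain ⟨g, hg, hgs, rfl⟩ := mem_coord.mp hd
  refine mem_coord.mpr ⟨f * g * f⁻¹, P'.mul_mem (P'.mul_mem (h hf) hg) (P'.inv_mem (h hf)), ?_, rfl⟩
  intro i hi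
  simp [hgs i hi]

/-- Finiteness of an index in a finite power can be tested on coordinates, by trivializing the
coordinates one at a time. -/
theorem relIndex_ne_zero_of_coord [Finite ι] {P P' : Subgroup (ι → A)} (h : P ≤ P')
    (hc : ∀ s j, (coord P s j).relIndex (coord P' s j) ≠ 0) : P.relIndex P' ≠ 0 := by
  classical
  have := Fintype.ofFinite ι
  set V : Finset ι → Subgroup (ι → A) := fun s => Subgroup.pi (s : Set ι) fun _ => ⊥
  have key : ∀ t : Finset ι, (P ⊓ V tᶜ).relIndex (P' ⊓ V tᶜ) ≠ 0 := by
    intro t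
    induction t using Finset.induction_on with
    | empty =>
      have e : P' ⊓ V ∅ᶜ = ⊥ := by
        rw [eq_bot_iff]
        rintro f ⟨-, hf⟩
        rw [Subgroup.mem_bot]
        funext i
        exact hf i (by simp)
      rw [e, Subgroup.relIndex_bot_right]
      exact one_ne_zero
    | insert j t hj ih =>
      have e : ∀ R : Subgroup (ι → A), R ⊓ V (insert j t)ᶜ ⊓ (Pi.evalMonoidHom (fun _ => A) j).ker =
          R ⊓ V tᶜ := by
        intro R
        rw [inf_assoc]
        congr 1
        ext f
        simp only [V, Subgroup.mem_inf, Subgroup.mem_pi, MonoidHom.mem_ker, Subgroup.mem_bot,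
          Finset.mem_coe, Finset.mem_compl, Finset.mem_insert, not_or, Pi.evalMonoidHom_apply]
        constructor
        · rintro ⟨h1, h2⟩ i hi
          by_cases hij : i = j
          · rw [hij, h2]
          · exact h1 i ⟨hij, hi⟩
        · exact fun h1 => ⟨fun i hi => h1 i hi.2, h1 j hj⟩
      refine relIndex_ne_zero_of_map_of_ker (Pi.evalMonoidHom (fun _ => A) j)
        (inf_le_inf_right _ h) (hc _ j) ?_
      rw [e, e]
      exact ih
  have h1 := key Finset.univ
  have e : V Finset.univᶜ = ⊤ := by
    rw [eq_top_iff]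
    intro f _ i hi
    simp at hi
  rwa [e, inf_top_eq, inf_top_eq] at h1

theorem relIndex_map_ne_zero {B : Type*} [Group B] (f : A →* B) {P Q : Subgroup A}
    (h : P.relIndex Q ≠ 0) : (P.map f).relIndex (Q.map f) ≠ 0 := by
  rw [← Subgroup.relIndex_comap]
  exact fun h' => h (Subgroup.relIndex_eq_zero_of_le_left (Subgroup.le_comap_map f P) h')

end Coordinates

section Tree

variable {X : Type u} {G K : Subgroup (TreeAut X)}

/-- The image of `st_L(Y)` under `ψ_Y`. -/
def sectionImage (Y : Set (List X)) (L : Subgroup (TreeAut X)) : Subgroup (Y → TreeAut X) :=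
  (L.subgroupOf (stab Y)).map (psi Y)

theorem mem_sectionImage {Y : Set (List X)} {L : Subgroup (TreeAut X)} {f : Y → TreeAut X} :
    f ∈ sectionImage Y L ↔ ∃ g : stab Y, (g : TreeAut X) ∈ L ∧ psi Y g = f :=
  Iff.rfl

theorem sectionImage_mono (Y : Set (List X)) {L M : Subgroup (TreeAut X)} (h : L ≤ M) :
    sectionImage Y L ≤ sectionImage Y M :=
  Subgroup.map_mono (Subgroup.comap_mono h)

theorem coord_sectionImage_le (hG : SelfSimilar G) {Y : Set (List X)} {L : Subgroup (TreeAut X)}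
    (hL : L ≤ G) (s : Finset Y) (j : Y) : coord (sectionImage Y L) s j ≤ G := by
  intro a ha
  obtain ⟨f, hf, -, rfl⟩ := mem_coord.mp ha
  obtain ⟨g, hg, rfl⟩ := mem_sectionImage.mp hf
  exact hG _ (hL hg) _

/-- Every vertex is comparable with a vertex of `Y`. -/
def Meets (Y : Set (List X)) : Prop := ∀ w : List X, ∃ y ∈ Y, y <+: w ∨ w <+: y

theorem meets_of_forall_length [Nonempty X] {Y : Set (List X)} {N : ℕ}
    (h : ∀ w : List X, N ≤ w.length → ∃ y ∈ Y, y <+: w) : Meets Y := by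
  intro w
  obtain ⟨x⟩ := ‹Nonempty X›
  obtain ⟨y, hy, hyw⟩ := h (w ++ List.replicate N x) (by simp)
  exact ⟨y, hy, List.prefix_or_prefix_of_prefix hyw (List.prefix_append _ _)⟩

theorem meets_level [Nonempty X] (m : ℕ) : Meets (level X m) :=
  meets_of_forall_length (N := m) fun w hw =>
    ⟨w.take m, by simp [level, hw], List.take_prefix m w⟩

theorem psi_injective {Y : Set (List X)} (hY : Meets Y) : Function.Injective (psi Y) := by
  rw [injective_iff_map_eq_one]
  intro g hg
  ext1
  ext1 w
  obtain ⟨y, hy, ⟨t, rfl⟩ | h⟩ := hY w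
  · exact (treeSection_eq_one_iff (g.2 y hy)).mp (congrFun hg ⟨y, hy⟩) t
  · exact apply_eq_of_prefix h (g.2 y hy)

theorem relIndex_ne_zero_of_sectionImage [Finite X] {Y : Set (List X)} (hfin : Y.Finite)
    (hY : Meets Y) {L M : Subgroup (TreeAut X)}
    (h : (sectionImage Y L).relIndex (sectionImage Y M) ≠ 0) : L.relIndex M ≠ 0 := by
  have h1 : L.relIndex (stab Y ⊓ M) ≠ 0 := by
    rwa [sectionImage, sectionImage, Subgroup.relIndex_map_map_of_injective _ _ (psi_injective hY),
      Subgroup.subgroupOf, Subgroup.relIndex_comap, Subgroup.subgroupOf_map_subtype, inf_comm] at h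
  intro h0
  exact mul_ne_zero h1 (relIndex_stab_ne_zero hfin M)
    ((Subgroup.relIndex_inf_mul_relIndex _ _ _).trans
      (Subgroup.relIndex_eq_zero_of_le_left inf_le_left h0))

/-- Let `D ≤ D'` be subgroups of `G`, with `D` normalized by a finite index subgroup of `G`. If `D'`
is resolved at level `m`, where `D` and `D'` move the same vertices, then `D` has finite index in
`D'`: both are commensurable with the product of the copies of `G` at the moved vertices. -/
theorem relIndex_ne_zero_of_moved_eq [Finite X] [Nonempty X] (hG : JustInfinite G)
    (hs : SelfSimilar G) (hK : IsBranchingSubgroup K G) {D D' Q : Subgroup (TreeAut X)}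
    (hD : D ≤ D') (hD' : D' ≤ G) (hDQ : NormalizedBy D Q) (hQ : Q.relIndex G ≠ 0) {m : ℕ}
    (hm : Resolves D' m) (h : moved D' m ⊆ moved D m) : D.relIndex D' ≠ 0 := by
  have hfin := finite_level (X := X) m
  have := hfin.to_subtype
  refine relIndex_ne_zero_of_sectionImage hfin (meets_level m)
    (relIndex_ne_zero_of_coord (sectionImage_mono _ hD) fun s w => ?_)
  obtain ⟨w, hw⟩ := w
  by_cases htriv : coord (sectionImage (level X m) D') s ⟨w, hw⟩ = ⊥
  · rw [htriv, Subgroup.relIndex_bot_right]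
    exact one_ne_zero
  have hws : (⟨w, hw⟩ : level X m) ∉ s := by
    refine fun hws => htriv (eq_bot_iff.mpr fun a ha => ?_)
    obtain ⟨f, -, hf, rfl⟩ := mem_coord.mp ha
    exact hf _ hws
  have hwm : w ∈ moved D m := by
    refine h (by_contra fun hwm => htriv (eq_bot_iff.mpr fun a ha => ?_))
    obtain ⟨f, hf, -, rfl⟩ := mem_coord.mp ha
    obtain ⟨g, hg, rfl⟩ := mem_sectionImage.mp hf
    exact (treeSection_eq_one_iff (g.2 w hw)).mpr (hm w hw hwm g hg)
  have h1 : D.comap (graft w) ≤ coord (sectionImage (level X m) D) s ⟨w, hw⟩ := by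
    intro a ha
    have hst : graft w a ∈ stab (level X m) := by
      intro y hy
      by_cases hwy : w <+: y
      · rw [← hwy.eq_of_length (Eq.trans hw (Eq.symm hy)), graft_apply_self]
      · exact graft_apply_of_not_prefix a hwy
    refine mem_coord.mpr ⟨psi _ ⟨graft w a, hst⟩, ⟨_, ha, rfl⟩, ?_, treeSection_graft w a⟩
    rintro ⟨y, hy⟩ hys
    refine (treeSection_eq_one_iff (hst y hy)).mpr fun t =>
      graft_apply_of_not_prefix a fun hwy => ?_
    have hyw : w = y :=
      eq_of_prefix_of_prefix (Eq.trans hw (Eq.symm hy)) hwy (List.prefix_append y t)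
    subst hyw
    exact hws hys
  refine fun h0 => relIndex_comap_graft_ne_zero_of_moves hG hK hDQ hQ hwm.2 ?_
  exact Subgroup.relIndex_eq_zero_of_le_right (coord_sectionImage_le hs hD' s _)
    (Subgroup.relIndex_eq_zero_of_le_left h1 h0)

/-! ### Subgroups containing an infra-direct product -/

/-- `st_L(Y)` is an infra-direct product of `G^Y` for some spanning leaf set `Y`. -/
def ContainsInfraDirect (G L : Subgroup (TreeAut X)) : Prop :=
  ∃ Y : Finset (List X), IsSpanningLeafSet Y ∧
    IsInfraDirect G (sectionImage (Y : Set (List X)) L)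

theorem ContainsInfraDirect.mono (hs : SelfSimilar G) {L M : Subgroup (TreeAut X)} (h : L ≤ M)
    (hM : M ≤ G) (hL : ContainsInfraDirect G L) : ContainsInfraDirect G M := by
  obtain ⟨Y, hY, -, hL⟩ := hL
  refine ⟨Y, hY, ?_, fun y h0 => hL y ?_⟩
  · intro f hf j _
    obtain ⟨g, hg, rfl⟩ := mem_sectionImage.mp hf
    exact hs _ (hM hg) _
  · exact Subgroup.relIndex_eq_zero_of_le_left (Subgroup.map_mono (sectionImage_mono _ h)) h0

/-- An inclusion of infinite index between overgroups of `L`, where `st_L(Y)` is infra-direct, is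
witnessed, in one of the coordinates, by a vertex that is moved by the larger group only. -/
theorem exists_moved_of_relIndex_eq_zero [Finite X] [Nonempty X] (hG : JustInfinite G)
    (hs : SelfSimilar G) (hK : IsBranchingSubgroup K G) {Y : Set (List X)} (hfin : Y.Finite)
    (hY : Meets Y) {L M M' : Subgroup (TreeAut X)}
    (hL : ∀ j, (coord (sectionImage Y L) ∅ j).relIndex G ≠ 0) (hLM : L ≤ M) (hM : M ≤ M')
    (hM' : M' ≤ G) (h : M.relIndex M' = 0) :
    ∃ s j, ∀ m, Resolves (coord (sectionImage Y M') s j) m →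
      ∃ w ∈ moved (coord (sectionImage Y M') s j) m,
        w ∉ moved (coord (sectionImage Y M) s j) m := by
  have := hfin.to_subtype
  by_contra! hcon
  refine relIndex_ne_zero_of_sectionImage hfin hY
    (relIndex_ne_zero_of_coord (sectionImage_mono _ hM) fun s j => ?_) h
  obtain ⟨m, hm, hsub⟩ := hcon s j
  exact relIndex_ne_zero_of_moved_eq hG hs hK (coord_mono (sectionImage_mono _ hM) s j)
    (coord_sectionImage_le hs hM' s j) (normalizedBy_coord (sectionImage_mono _ hLM) s j) (hL j) hm
    hsub

/-- The lengths of chains of infinite index inclusions above a subgroup containing an infra-direct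
product are bounded: each inclusion increases, in some coordinate, the proportion of moved vertices
by a fixed amount. -/
theorem ContainsInfraDirect.exists_chain_bound [Finite X] [Nonempty X] (hG : JustInfinite G)
    (hs : SelfSimilar G) (ht : LevelTransitive G) (hK : IsBranchingSubgroup K G)
    {L : Subgroup (TreeAut X)} (hL : ContainsInfraDirect G L) :
    ∃ c : ℕ, ∀ (k : ℕ) (H : ℕ → Subgroup (TreeAut X)), Monotone H → L ≤ H 0 → (∀ i, H i ≤ G) →
      (∀ i < k, (H i).relIndex (H (i + 1)) = 0) → k ≤ c := by
  classical
  obtain ⟨Y, ⟨-, N, hN⟩, -, hL⟩ := hL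
  set Z : Set (List X) := (Y : Set (List X))
  have hfin : Z.Finite := Y.finite_toSet
  have hZ : Meets Z := meets_of_forall_length hN
  have hL' : ∀ j, (coord (sectionImage Z L) ∅ j).relIndex G ≠ 0 := fun j => by
    rw [coord_empty]
    exact hL j
  have := hfin.fintype
  set C := ∑ j : Z, (coord (sectionImage Z L) ∅ j).relIndex G
  refine ⟨C * Fintype.card (Finset Z × Z), fun k H hmono hLH hHG hjump => ?_⟩
  have hLi : ∀ i, L ≤ H i := fun i => hLH.trans (hmono (Nat.zero_le i))
  have hnorm : ∀ i (p : Finset Z × Z),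
      NormalizedBy (coord (sectionImage Z (H i)) p.1 p.2) (coord (sectionImage Z L) ∅ p.2) :=
    fun i p => normalizedBy_coord (sectionImage_mono _ (hLi i)) _ _
  -- a level at which all groups in question are resolved
  obtain ⟨m, hm⟩ : ∃ m, ∀ i ∈ Finset.range (k + 1), ∀ p : Finset Z × Z,
      Resolves (coord (sectionImage Z (H i)) p.1 p.2) m := by
    refine Filter.Eventually.exists (f := Filter.atTop) ?_
    rw [Filter.eventually_all_finset]
    intro i _
    rw [Filter.eventually_all]
    exact fun p => eventually_resolves ht (hnorm i p) (hL' p.2)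
  set S : ℕ → Finset Z × Z → Set (List X) :=
    fun i p => moved (coord (sectionImage Z (H i)) p.1 p.2) m
  have hSfin : ∀ i p, (S i p).Finite := fun i p =>
    (finite_level m).subset (moved_subset_level _ m)
  have hstep : ∀ i < k, Nat.card X ^ m + C * ∑ p, (S i p).ncard ≤
      C * ∑ p, (S (i + 1) p).ncard := by
    intro i hi
    have hsub : ∀ p, S i p ⊆ S (i + 1) p := fun p =>
      moved_mono (coord_mono (sectionImage_mono _ (hmono (Nat.le_succ i))) _ _) m
    obtain ⟨s, j, hsj⟩ := exists_moved_of_relIndex_eq_zero hG hs hK hfin hZ hL' (hLi i)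
      (hmono (Nat.le_succ i)) (hHG (i + 1)) (hjump i hi)
    obtain ⟨w, hw, hwn⟩ := hsj m (hm (i + 1) (Finset.mem_range.mpr (by omega)) (s, j))
    have h1 : Nat.card X ^ m ≤
        (coord (sectionImage Z L) ∅ j).relIndex G * (S (i + 1) (s, j) \ S i (s, j)).ncard := by
      refine card_pow_le_of_invariant ht (hL' j)
        (Set.sdiff_subset.trans (moved_subset_level _ m)) ⟨w, hw, hwn⟩ ?_
      rintro q hq v ⟨hv, hvn⟩
      refine ⟨apply_mem_moved (hnorm (i + 1) (s, j)) hq hv, fun h => hvn ?_⟩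
      have := apply_mem_moved (hnorm i (s, j)) (inv_mem hq) h
      rwa [inv_apply_apply] at this
    have h2 : Nat.card X ^ m ≤ C * (S (i + 1) (s, j) \ S i (s, j)).ncard :=
      h1.trans (Nat.mul_le_mul_right _ (Finset.single_le_sum
        (f := fun j => (coord (sectionImage Z L) ∅ j).relIndex G) (fun _ _ => Nat.zero_le _)
        (Finset.mem_univ j)))
    have h3 : ∑ p, (S i p).ncard + (S (i + 1) (s, j) \ S i (s, j)).ncard ≤
        ∑ p, (S (i + 1) p).ncard := by
      rw [← Finset.sum_erase_add _ (fun p => (S i p).ncard) (Finset.mem_univ (s, j)),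
        ← Finset.sum_erase_add _ (fun p => (S (i + 1) p).ncard) (Finset.mem_univ (s, j)),
        add_assoc]
      refine Nat.add_le_add
        (Finset.sum_le_sum fun p _ => Set.ncard_le_ncard (hsub p) (hSfin _ p)) ?_
      rw [add_comm, Set.ncard_sdiff_add_ncard_of_subset (hsub _) (hSfin _ _)]
    calc _ ≤ C * (S (i + 1) (s, j) \ S i (s, j)).ncard + C * ∑ p, (S i p).ncard :=
          Nat.add_le_add_right h2 _
      _ ≤ _ := by
          rw [← Nat.mul_add, add_comm]
          exact Nat.mul_le_mul_left _ h3
  have hgrow : ∀ i ≤ k, i * Nat.card X ^ m ≤ C * ∑ p, (S i p).ncard := by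
    intro i hi
    induction i with
    | zero => simp
    | succ i ih =>
      have h1 := ih (by omega)
      have h2 := hstep i (by omega)
      rw [add_mul, one_mul]
      omega
  have hbound : ∑ p, (S k p).ncard ≤ Fintype.card (Finset Z × Z) * Nat.card X ^ m := by
    rw [← ncard_level, ← smul_eq_mul, ← Finset.card_univ]
    exact Finset.sum_le_card_nsmul _ _ _ fun p _ =>
      Set.ncard_le_ncard (moved_subset_level _ m) (finite_level m)
  have h := (hgrow k le_rfl).trans (Nat.mul_le_mul_left C hbound)
  rw [← mul_assoc] at h
  exact Nat.le_of_mul_le_mul_right h (pow_pos Nat.card_pos m)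

/-- A group of elements commensurating `L`, for `L` containing an infra-direct product, contains `L`
with finite index. Otherwise, in some coordinate, it contains a nontrivial element `k` supported
below a vertex below which the corresponding coordinate of `L` is trivial, and as `k` commensurates
`L` it commutes with a finite index subgroup of the copy of `G` there. -/
theorem ContainsInfraDirect.relIndex_ne_zero_of_commensurates [Finite X] [Nonempty X]
    (hG : JustInfinite G) (hs : SelfSimilar G) (ht : LevelTransitive G)
    (hK : IsBranchingSubgroup K G) {L E : Subgroup (TreeAut X)} (hL : ContainsInfraDirect G L)
    (hLE : L ≤ E) (hE : E ≤ G)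
    (hcomm : ∀ e ∈ E, (L.comap (MulAut.conj e).toMonoidHom).relIndex L ≠ 0) :
    L.relIndex E ≠ 0 := by
  have := hG.1
  obtain ⟨Y, ⟨-, N, hN⟩, -, hL⟩ := hL
  set Z : Set (List X) := (Y : Set (List X))
  have hfin : Z.Finite := Y.finite_toSet
  have hZ : Meets Z := meets_of_forall_length hN
  have hL' : ∀ j, (coord (sectionImage Z L) ∅ j).relIndex G ≠ 0 := fun j => by
    rw [coord_empty]
    exact hL j
  intro h0
  obtain ⟨s, j, hsj⟩ :=
    exists_moved_of_relIndex_eq_zero hG hs hK hfin hZ hL' le_rfl hLE hE h0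
  have hnL := normalizedBy_coord (le_refl (sectionImage Z L)) s j
  have hnE := normalizedBy_coord (sectionImage_mono Z hLE) s j
  obtain ⟨m, hmL, hmE⟩ :=
    ((eventually_resolves ht hnL (hL' j)).and (eventually_resolves ht hnE (hL' j))).exists
  obtain ⟨w, hwE, hwL⟩ := hsj m hmE
  obtain ⟨k, hk, -, hk1⟩ := exists_mem_ne_one_of_relIndex_ne_zero
    (relIndex_comap_graft_ne_zero_of_moves hG hK hnE (hL' j) hwE.2)
  obtain ⟨f, hf, hfs, hfj⟩ := mem_coord.mp hk
  obtain ⟨e, he, rfl⟩ := mem_sectionImage.mp hf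
  -- the elements of `L` that are conjugated into `L` by `e`
  set R := L.comap (MulAut.conj (e : TreeAut X)).toMonoidHom ⊓ L
  have hR : (coord (sectionImage Z R) ∅ j).relIndex G ≠ 0 := by
    refine Subgroup.relIndex_ne_zero_trans ?_ (hL' j)
    rw [coord_empty, coord_empty]
    refine relIndex_map_ne_zero _ (relIndex_map_ne_zero _ (Subgroup.relIndex_comap_ne_zero _ ?_))
    rw [Subgroup.inf_relIndex_right]
    exact hcomm e he
  refine hk1 (eq_one_of_commute hK (relIndex_comap_graft_inf_ne_zero hK w hR) fun b hb => ?_)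
  obtain ⟨f, hf, -, hbj⟩ := mem_coord.mp hb.1
  obtain ⟨l, hl, rfl⟩ := mem_sectionImage.mp hf
  have hx : graft w (k * b * k⁻¹ * b⁻¹) ∈ coord (sectionImage Z L) s j := by
    refine mem_coord.mpr ⟨psi Z (e * l * e⁻¹ * l⁻¹), ⟨_, ?_, rfl⟩, fun i hi => ?_, ?_⟩
    · exact L.mul_mem hl.1 (L.inv_mem hl.2)
    · simp [map_mul, map_inv, hfs i hi]
    · simp [map_mul, map_inv, hfj, hbj]
  have h1 := hmL w hwE.1 hwL _ hx
  have h2 : k * b * k⁻¹ * b⁻¹ = 1 := by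
    ext1 t
    have := h1 t
    rw [graft_apply_append] at this
    exact List.append_cancel_left this
  rwa [mul_inv_eq_one, mul_inv_eq_iff_eq_mul] at h2

end Tree

/-! ### The space of subgroups -/

section Chabauty

open Filter Topology CantorBendixson

variable {A : Type*} [Group A]

theorem tendsto_nhds_subgroup_iff {ι : Type*} {l : Filter ι} {f : ι → Subgroup A}
    {H : Subgroup A} : Tendsto f l (𝓝 H) ↔ ∀ a, ∀ᶠ i in l, (a ∈ f i ↔ a ∈ H) := by
  rw [nhds_induced, tendsto_comap_iff, tendsto_pi_nhds]
  refine forall_congr' fun a => ?_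
  rw [nhds_discrete, tendsto_pure]
  simp only [Function.comp_apply, decide_eq_decide]

theorem eventually_mem_iff (H : Subgroup A) (a : A) : ∀ᶠ M in 𝓝 H, (a ∈ M ↔ a ∈ H) :=
  tendsto_nhds_subgroup_iff.mp tendsto_id a

theorem eventually_ge_of_fg {H : Subgroup A} (hH : H.FG) : ∀ᶠ M in 𝓝 H, H ≤ M := by
  obtain ⟨S, rfl⟩ := hH
  have h : ∀ᶠ M in 𝓝 (Subgroup.closure (S : Set A)), ∀ a ∈ S, a ∈ M := by
    rw [eventually_all_finset]
    intro a ha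
    filter_upwards [eventually_mem_iff (Subgroup.closure (S : Set A)) a] with M hM
    exact hM.mpr (Subgroup.subset_closure ha)
  filter_upwards [h] with M hM
  exact (Subgroup.closure_le M).mpr hM

/-- Every subgroup is a limit of its finitely generated subgroups. -/
theorem exists_fg_le_notMem {P : Set (Subgroup A)} (hP : IsClosed P) {L : Subgroup A}
    (hL : L ∉ P) : ∃ H ≤ L, H.FG ∧ H ∉ P := by
  classical
  by_contra! hcon
  refine hL (hP.mem_of_tendsto (f := fun F : Finset A => Subgroup.closure ((F : Set A) ∩ L))
    (b := atTop) (tendsto_nhds_subgroup_iff.mpr fun a => ?_) (Eventually.of_forall fun F => ?_))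
  · filter_upwards [eventually_ge_atTop {a}] with F hF
    have hle : Subgroup.closure ((F : Set A) ∩ L) ≤ L :=
      (Subgroup.closure_le L).mpr Set.inter_subset_right
    exact ⟨fun h => hle h, fun h => Subgroup.subset_closure ⟨hF (Finset.mem_singleton_self a), h⟩⟩
  · refine hcon _ ((Subgroup.closure_le L).mpr Set.inter_subset_right) ?_
    exact (Subgroup.fg_iff _).mpr ⟨_, rfl, F.finite_toSet.inter_of_left _⟩

theorem fg_map_subtype {G : Subgroup A} {H : Subgroup G} (hH : H.FG) : (H.map G.subtype).FG := by
  obtain ⟨S, rfl⟩ := hH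
  rw [MonoidHom.map_closure]
  exact (Subgroup.fg_iff _).mpr ⟨_, rfl, S.finite_toSet.image _⟩

theorem fg_of_relIndex_ne_zero {H M : Subgroup A} (hHM : H ≤ M) (hH : H.FG)
    (h : H.relIndex M ≠ 0) : M.FG := by
  have : Finite (M ⧸ H.subgroupOf M) := Nat.finite_of_card_ne_zero h
  set T : Set A := Set.range fun q : M ⧸ H.subgroupOf M => (q.out : A)
  have hT : T.Finite := Set.finite_range _
  have e : M = H ⊔ Subgroup.closure T := by
    apply le_antisymm
    · intro a ha
      obtain ⟨b, hb⟩ := QuotientGroup.mk_out_eq_mul (H.subgroupOf M) ⟨a, ha⟩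
      have h1 : ((QuotientGroup.mk (⟨a, ha⟩ : M) : M ⧸ H.subgroupOf M).out : A) = a * (b : M) := by
        rw [hb]
        rfl
      have h2 : a =
          (QuotientGroup.mk (⟨a, ha⟩ : M) : M ⧸ H.subgroupOf M).out * ((b : M) : A)⁻¹ := by
        rw [h1, mul_inv_cancel_right]
      rw [h2]
      exact Subgroup.mul_mem _ (Subgroup.mem_sup_right (Subgroup.subset_closure ⟨_, rfl⟩))
        (Subgroup.mem_sup_left (H.inv_mem b.2))
    · refine sup_le hHM ((Subgroup.closure_le M).mpr ?_)
      rintro _ ⟨q, rfl⟩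
      exact q.out.2
  rw [e]
  exact hH.sup ((Subgroup.fg_iff _).mpr ⟨T, rfl, hT⟩)

/-! ### Depth -/

theorem HasInfiniteIndexChain.succ {L M : Subgroup A} {n : ℕ} (hM : HasInfiniteIndexChain M n)
    (hLM : L ≤ M) (h : L.relIndex M = 0) : HasInfiniteIndexChain L (n + 1) := by
  obtain ⟨H, h0, hn, hH⟩ := hM
  refine ⟨fun i => if i ≤ n then H i else L, by simpa using h0, by simp, fun i hi => ?_⟩
  rcases Nat.lt_succ_iff_lt_or_eq.mp hi with hi | rfl
  · simpa [hi.le, Nat.succ_le_of_lt hi] using hH i hi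
  · simp only [le_refl, if_true, Nat.not_succ_le_self, if_false, hn]
    refine ⟨lt_of_le_of_ne hLM ?_, h⟩
    rintro rfl
    rw [Subgroup.relIndex_self] at h
    exact one_ne_zero h

theorem HasInfiniteIndexChain.exists_of_succ {L : Subgroup A} {n : ℕ}
    (hL : HasInfiniteIndexChain L (n + 1)) :
    ∃ M, HasInfiniteIndexChain M n ∧ L ≤ M ∧ L.relIndex M = 0 := by
  obtain ⟨H, h0, rfl, hH⟩ := hL
  exact ⟨H n, ⟨H, h0, rfl, fun i hi => hH i (by omega)⟩, (hH n (by omega)).1.le,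
    (hH n (by omega)).2⟩

theorem exists_chain_of_lt_depth {L : Subgroup A} {n : ℕ} (h : (n : ℕ∞) < depth L) :
    ∃ k > n, HasInfiniteIndexChain L k := by
  rw [depth] at h
  simp only [lt_iSup_iff] at h
  obtain ⟨k, hk, hnk⟩ := h
  exact ⟨k, Nat.cast_lt.mp hnk, hk⟩

theorem le_depth {L : Subgroup A} {n : ℕ} (h : HasInfiniteIndexChain L n) : (n : ℕ∞) ≤ depth L :=
  le_iSup₂ (f := fun (n : ℕ) (_ : HasInfiniteIndexChain L n) => (n : ℕ∞)) n h

theorem succ_le_depth {L M : Subgroup A} (hLM : L ≤ M) (h : L.relIndex M = 0) {n : ℕ}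
    (hn : (n : ℕ∞) ≤ depth M) : ((n + 1 : ℕ) : ℕ∞) ≤ depth L := by
  rcases n with _ | n
  · refine le_depth (HasInfiniteIndexChain.succ (M := ⊤) ?_ le_top ?_)
    · exact ⟨fun _ => ⊤, rfl, rfl, fun i hi => absurd hi (Nat.not_lt_zero i)⟩
    · exact Subgroup.relIndex_eq_zero_of_le_right le_top h
  · obtain ⟨k, hk, hc⟩ := exists_chain_of_lt_depth
      (lt_of_lt_of_le (Nat.cast_lt.mpr (Nat.lt_succ_self n)) hn)
    refine le_trans ?_ (le_depth (hc.succ hLM h))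
    exact_mod_cast Nat.succ_le_succ hk

/-! ### Rank and depth -/

variable {A : Type u} [Group A]

theorem mem_iteratedDerivedSet_nat_succ {S : Type u} [TopologicalSpace S] {x : S} {n : ℕ} :
    x ∈ iteratedDerivedSet (Set.univ : Set S) ((n + 1 : ℕ) : Ordinal.{u}) ↔
      x ∈ iteratedDerivedSet (Set.univ : Set S) (n : Ordinal.{u}) ∧
        ∃ᶠ y in 𝓝 x, y ≠ x ∧ y ∈ iteratedDerivedSet (Set.univ : Set S) (n : Ordinal.{u}) := by
  rw [Nat.cast_succ, iteratedDerivedSet_succ, ← accPt_iff_frequently]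
  exact and_comm

/-- All overgroups `M` of `L` have finite depth, and all finite index overgroups of such an `M` lie
in a common one. -/
structure HasBoundedOvergroups (L : Subgroup A) : Prop where
  depth_ne_top : ∀ M, L ≤ M → depth M ≠ ⊤
  exists_finite_index_bound : ∀ M, L ≤ M → ∃ E, M.relIndex E ≠ 0 ∧
    ∀ M', M ≤ M' → M.relIndex M' ≠ 0 → M' ≤ E

theorem HasBoundedOvergroups.fg {L : Subgroup A} (hL : HasBoundedOvergroups L) (hfg : L.FG)
    {M : Subgroup A} (hLM : L ≤ M) : M.FG := by
  -- choose a finitely generated subgroup of minimal depth between `L` and `M`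
  obtain ⟨N, ⟨⟨hLN, hNM, hN⟩, hmin⟩⟩ := exists_minimalFor_of_wellFoundedLT
    (fun N : Subgroup A => L ≤ N ∧ N ≤ M ∧ N.FG) depth ⟨L, le_rfl, hLM, hfg⟩
  obtain ⟨E, hE, hmax⟩ := hL.exists_finite_index_bound N hLN
  have hME : M ≤ E := by
    intro a ha
    have hle : N ⊔ Subgroup.closure {a} ≤ M := sup_le hNM (by simpa using ha)
    refine hmax (N ⊔ Subgroup.closure {a}) le_sup_left (fun h0 => ?_)
      (Subgroup.mem_sup_right (Subgroup.subset_closure rfl))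
    obtain ⟨d, hd⟩ := ENat.ne_top_iff_exists.mp (hL.depth_ne_top _ (hLN.trans
      (le_sup_left : N ≤ N ⊔ Subgroup.closure {a})))
    have h1 := succ_le_depth le_sup_left h0 hd.le
    have h2 : depth N ≤ depth (N ⊔ Subgroup.closure {a}) := by
      refine (le_total _ _).elim id fun h => hmin ⟨hLN.trans le_sup_left, hle, ?_⟩ h
      exact hN.sup ⟨{a}, by simp⟩
    rw [← hd] at h2
    exact absurd (Nat.cast_le.mp (h1.trans h2)) (Nat.not_succ_le_self d)
  exact fg_of_relIndex_ne_zero hNM hN fun h0 =>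
    hE (Subgroup.relIndex_eq_zero_of_le_right hME h0)

/-- A subgroup of the end of a chain of length `n` has rank at least `n`: if `M` has infinite index
in `P`, then `M` is the limit of the finite index subgroups `P ∩ M st(k)` of `P`. -/
theorem HasBoundedOvergroups.mem_iteratedDerivedSet {L : Subgroup A} (hL : HasBoundedOvergroups L)
    (hfg : L.FG) {st : ℕ → Subgroup A} (hst : Antitone st) (hfi : ∀ k, (st k).index ≠ 0)
    (happ : ∀ M : Subgroup A, M.FG → ∀ a ∉ M, ∃ k, a ∉ M ⊔ st k) (n : ℕ) {M N : Subgroup A}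
    (hLM : L ≤ M) (hMN : M ≤ N) (hN : HasInfiniteIndexChain N n) :
    M ∈ iteratedDerivedSet (Set.univ : Set (Subgroup A)) (n : Ordinal.{u}) := by
  induction n generalizing M N with
  | zero => simp
  | succ n ih =>
    obtain ⟨P, hP, hNP, hP0⟩ := hN.exists_of_succ
    have hMP : M ≤ P := hMN.trans hNP
    have hMP0 : M.relIndex P = 0 := Subgroup.relIndex_eq_zero_of_le_left hMN hP0
    have hfin : ∀ k, (P ⊓ (M ⊔ st k)).relIndex P ≠ 0 := by
      intro k h
      rw [Subgroup.inf_relIndex_left] at h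
      exact hfi k (Subgroup.index_eq_zero_of_relIndex_eq_zero
        (Subgroup.relIndex_eq_zero_of_le_left le_sup_right h))
    have hle : ∀ k, M ≤ P ⊓ (M ⊔ st k) := fun k => le_inf hMP le_sup_left
    have hmem : ∀ k, P ⊓ (M ⊔ st k) ∈
        iteratedDerivedSet (Set.univ : Set (Subgroup A)) (n : Ordinal.{u}) := fun k =>
      ih (hLM.trans (hle k)) inf_le_left hP
    have hlim : Tendsto (fun k => P ⊓ (M ⊔ st k)) atTop (𝓝 M) := by
      rw [tendsto_nhds_subgroup_iff]
      intro a
      by_cases ha : a ∈ M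
      · exact Eventually.of_forall fun k => ⟨fun _ => ha, fun _ => hle k ha⟩
      · obtain ⟨k, hk⟩ := happ M (hL.fg hfg hLM) a ha
        filter_upwards [eventually_ge_atTop k] with i hi
        exact ⟨fun h => absurd (sup_le_sup_left (hst hi) M h.2) hk, fun h => absurd h ha⟩
    have hfreq : ∃ᶠ y in 𝓝 M, y ≠ M ∧
        y ∈ iteratedDerivedSet (Set.univ : Set (Subgroup A)) (n : Ordinal.{u}) := by
      refine hlim.frequently (Frequently.of_forall fun k => ⟨fun h => hfin k ?_, hmem k⟩)
      rw [h, hMP0]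
    refine mem_iteratedDerivedSet_nat_succ.mpr ⟨?_, hfreq⟩
    have hcl : IsClosed (iteratedDerivedSet (Set.univ : Set (Subgroup A)) (n : Ordinal.{u})) :=
      isClosed_iteratedDerivedSet isClosed_univ _
    exact hcl.mem_of_tendsto hlim (Eventually.of_forall hmem)

/-- Near `M`, all other subgroups contain `M` with infinite index, so the rank is at most the
depth. -/
theorem HasBoundedOvergroups.le_depth_of_mem {L : Subgroup A} (hL : HasBoundedOvergroups L)
    (hfg : L.FG) (n : ℕ) {M : Subgroup A} (hLM : L ≤ M)
    (hM : M ∈ iteratedDerivedSet (Set.univ : Set (Subgroup A)) (n : Ordinal.{u})) :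
    (n : ℕ∞) ≤ depth M := by
  induction n generalizing M with
  | zero => simp
  | succ n ih =>
    obtain ⟨E, hE, hmax⟩ := hL.exists_finite_index_bound M hLM
    have : Finite (E ⧸ M.subgroupOf E) := Nat.finite_of_card_ne_zero hE
    have h1 : ∀ᶠ N in 𝓝 M, ∀ q : E ⧸ M.subgroupOf E, ((q.out : A) ∈ N ↔ (q.out : A) ∈ M) := by
      rw [eventually_all]
      exact fun q => eventually_mem_iff M _
    obtain ⟨N, ⟨hNM, hN⟩, hMN, hNq⟩ := ((mem_iteratedDerivedSet_nat_succ.mp hM).2.and_eventually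
      ((eventually_ge_of_fg (hL.fg hfg hLM)).and h1)).exists
    refine succ_le_depth hMN (by_contra fun h0 => hNM (le_antisymm ?_ hMN)) (ih (hLM.trans hMN) hN)
    intro a ha
    have haE : a ∈ E := hmax N hMN h0 ha
    obtain ⟨b, hb⟩ := QuotientGroup.mk_out_eq_mul (M.subgroupOf E) ⟨a, haE⟩
    have h2 : ((QuotientGroup.mk (⟨a, haE⟩ : E) : E ⧸ M.subgroupOf E).out : A) = a * (b : E) := by
      rw [hb]
      rfl
    have h3 := hNq (QuotientGroup.mk ⟨a, haE⟩)
    rw [h2] at h3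
    have hbM : ((b : E) : A) ∈ M := b.2
    exact (Subgroup.mul_mem_cancel_right M hbM).mp (h3.mp (N.mul_mem ha (hMN hbM)))

theorem HasBoundedOvergroups.cbRank_eq {L : Subgroup A} (hL : HasBoundedOvergroups L)
    (hfg : L.FG) {st : ℕ → Subgroup A} (hst : Antitone st) (hfi : ∀ k, (st k).index ≠ 0)
    (happ : ∀ M : Subgroup A, M.FG → ∀ a ∉ M, ∃ k, a ∉ M ⊔ st k) {M : Subgroup A} (hLM : L ≤ M) :
    ∃ d : ℕ, depth M = d ∧ cbRank M = ((d : Ordinal.{u}) : WithTop Ordinal.{u}) := by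
  obtain ⟨d, hd⟩ := ENat.ne_top_iff_exists.mp (hL.depth_ne_top M hLM)
  refine ⟨d, hd.symm, (cbRank_eq_coe_iff M _).mpr ⟨?_, fun h => ?_⟩⟩
  · rcases d with _ | d
    · simp
    · obtain ⟨k, hk, hc⟩ := exists_chain_of_lt_depth (L := M) (n := d) (by
        rw [← hd]
        exact_mod_cast Nat.lt_succ_self d)
      have h1 := le_depth hc
      rw [← hd] at h1
      obtain rfl : k = d + 1 := le_antisymm (Nat.cast_le.mp h1) hk
      exact hL.mem_iteratedDerivedSet hfg hst hfi happ _ hLM le_rfl hc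
  · rw [← Nat.cast_succ] at h
    have h1 := hL.le_depth_of_mem hfg _ hLM h
    rw [← hd] at h1
    exact absurd (Nat.cast_le.mp h1) (Nat.not_succ_le_self d)

end Chabauty

section

open Filter Topology CantorBendixson

variable {X : Type u} {G K : Subgroup (TreeAut X)}

/-! ### Subgroups with finitely many sections at a vertex -/

theorem nontrivial_of_infinite [Infinite G] : Nontrivial X := by
  by_contra h
  rw [not_nontrivial_iff_subsingleton] at h
  have : Subsingleton (TreeAut X) := ⟨fun a b => by
    ext1 w
    refine List.ext_getElem (by simp) fun i _ _ => Subsingleton.elim _ _⟩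
  exact not_finite G

theorem stab_level_antitone [Nonempty X] : Antitone fun n => stab (level X n) := by
  intro m n hmn g hg w hw
  obtain ⟨x⟩ := ‹Nonempty X›
  have hw : w.length = m := hw
  exact apply_eq_of_prefix (List.prefix_append w (List.replicate (n - m) x))
    (hg _ (by simp [level, hw, hmn]))

theorem normal_stab_level (n : ℕ) : (stab (level X n)).Normal :=
  ⟨fun g hg d w hw => by
    have h : (d⁻¹ w) ∈ level X n := (length_apply _ _).trans hw
    rw [RelIso.mul_apply, RelIso.mul_apply, hg _ h, apply_inv_apply]⟩

/-- If `H` has finitely many sections at a vertex, then its orbits on the subtree there are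
bounded, so deep down there are vertices `u` and `v` of that subtree in different orbits; adjoining
to `H` an element supported below `u` does not change the sections at `v`. -/
theorem exists_adjoin_finite_sections [Finite X] [Infinite G] (hK : IsBranchingSubgroup K G)
    {H : Subgroup (TreeAut X)} {y : List X}
    (hy : (treeSection y '' (H : Set (TreeAut X))).Finite) (n : ℕ) :
    ∃ g ∈ G, g ∈ stab (level X n) ∧ g ∉ H ∧ ∃ v,
      (treeSection v ''
        (Subgroup.closure ((H : Set (TreeAut X)) ∪ {g}) : Set (TreeAut X))).Finite := by
  have hKinf := infinite_of_relIndex_ne_zero hK.1 hK.2.2.1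
  have := nontrivial_of_infinite (G := G)
  have hN : 1 < Nat.card X := Finite.one_lt_card
  have hfin : ∀ z, (treeSection (y ++ z) '' (H : Set (TreeAut X))).Finite := by
    intro z
    refine (hy.image (treeSection z)).subset ?_
    rintro _ ⟨h, hh, rfl⟩
    exact ⟨_, ⟨h, hh, rfl⟩, (treeSection_append y z h).symm⟩
  -- a bound for the sizes of the orbits of `H` below `y`
  set S := treeSection y '' (H : Set (TreeAut X))
  set B := (level X y.length ×ˢ S).ncard
  have hBfin : (level X y.length ×ˢ S).Finite := (finite_level _).prod hy
  set m := max B n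
  obtain ⟨x⟩ : Nonempty X := inferInstance
  set v := y ++ List.replicate m x
  set O : Set (List X) := (fun h : TreeAut X => h v) '' (H : Set (TreeAut X))
  have hOsub : O ⊆ (fun p : List X × TreeAut X => p.1 ++ p.2 (List.replicate m x)) ''
      (level X y.length ×ˢ S) := by
    rintro _ ⟨h, hh, rfl⟩
    exact ⟨(h y, treeSection y h), ⟨length_apply h y, h, hh, rfl⟩, (apply_append_eq h y _).symm⟩
  have hOcard : O.ncard ≤ B :=
    (Set.ncard_le_ncard hOsub (hBfin.image _)).trans (Set.ncard_image_le hBfin)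
  have hBm : B < Nat.card X ^ m :=
    lt_of_lt_of_le (Nat.lt_pow_self hN) (Nat.pow_le_pow_right (by omega) (le_max_left _ _))
  obtain ⟨u, hu, huO⟩ : ∃ u ∈ (fun t => y ++ t) '' level X m, u ∉ O := by
    by_contra! hcon
    have h1 := Set.ncard_le_ncard hcon ((hBfin.image _).subset hOsub)
    rw [Set.ncard_image_of_injective _ (List.append_right_injective y), ncard_level] at h1
    omega
  obtain ⟨t, ht, rfl⟩ := hu
  have ht : t.length = m := ht
  set u := y ++ t
  have hO : ∀ o ∈ O, o.length = u.length := by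
    rintro _ ⟨h, -, rfl⟩
    simp [v, u, ht]
  obtain ⟨k, hkK, hk⟩ : ∃ k ∈ (K : Set (TreeAut X)), k ∉ treeSection u '' (H : Set (TreeAut X)) :=
    (Set.infinite_coe_iff.mp hKinf).exists_notMem_finite (hfin t)
  refine ⟨graft u k, hK.1 (graft_mem_of_mem hK u hkK), ?_,
    fun h => hk ⟨_, h, treeSection_graft u k⟩, v, ?_⟩
  · intro w hw
    have hw : w.length = n := hw
    by_cases hp : u <+: w
    · have hl : u.length = w.length := by
        refine le_antisymm hp.length_le ?_
        have : n ≤ m := le_max_right _ _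
        simp only [u, List.length_append]
        omega
      rw [← hp.eq_of_length hl, graft_apply_self]
    · exact graft_apply_of_not_prefix k hp
  · refine (hfin (List.replicate m x)).subset ?_
    -- every element of the larger group agrees below `v` with an element of `H`
    have key : ∀ a ∈ Subgroup.closure ((H : Set (TreeAut X)) ∪ {graft u k}),
        ∃ h ∈ H, ∀ w, a (v ++ w) = h (v ++ w) := by
      have hg : ∀ c : TreeAut X, ∀ h ∈ H, ∀ w, graft u c (h (v ++ w)) = h (v ++ w) := by
        intro c h hh w
        refine graft_apply_of_not_prefix c fun hp => huO ⟨h, hh, ?_⟩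
        refine eq_of_prefix_of_prefix (hO _ ⟨h, hh, rfl⟩) ?_ hp
        exact (apply_prefix h).mpr (List.prefix_append v w)
      intro a ha
      induction ha using Subgroup.closure_induction_left with
      | one => exact ⟨1, H.one_mem, fun _ => rfl⟩
      | mul_left s hs a _ ih =>
        obtain ⟨h, hh, e⟩ := ih
        rcases hs with hs | rfl
        · exact ⟨s * h, H.mul_mem hs hh, fun w => by rw [RelIso.mul_apply, RelIso.mul_apply, e]⟩
        · exact ⟨h, hh, fun w => by rw [RelIso.mul_apply, e, hg k h hh]⟩
      | inv_mul_cancel s hs a _ ih =>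
        obtain ⟨h, hh, e⟩ := ih
        rcases hs with hs | rfl
        · exact ⟨s⁻¹ * h, H.mul_mem (H.inv_mem hs) hh,
            fun w => by rw [RelIso.mul_apply, RelIso.mul_apply, e]⟩
        · exact ⟨h, hh, fun w => by rw [RelIso.mul_apply, e, ← map_inv, hg k⁻¹ h hh]⟩
    rintro _ ⟨a, ha, rfl⟩
    obtain ⟨h, hh, e⟩ := key a ha
    refine ⟨h, hh, ?_⟩
    ext1 w
    have h0 := e []
    rw [List.append_nil] at h0
    have h1 := e w
    rw [apply_append_eq, apply_append_eq h, h0] at h1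
    exact (List.append_cancel_left h1).symm

theorem exists_notMem_sup_stab (happ : WellApproximatedSubgroups G)
    {M : Subgroup G} (hM : M.FG) {a : G} (ha : a ∉ M) :
    ∃ n, a ∉ M ⊔ (stab (level X n)).subgroupOf G := by
  by_contra! hcon
  apply ha
  have h := happ (M.map G.subtype) (Subgroup.map_subtype_le M) (fg_map_subtype hM)
  have h1 : (a : TreeAut X) ∈ ((M.map G.subtype : Subgroup (TreeAut X)) : Set (TreeAut X)) := by
    rw [← h, Set.mem_iInter]
    intro n
    have := (normal_stab_level (X := X) n).subgroupOf G
    obtain ⟨b, hb, c, hc, rfl⟩ := Subgroup.mem_sup_of_normal_right.mp (hcon n)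
    exact ⟨b, ⟨b, hb, rfl⟩, c, ⟨c.2, hc⟩, rfl⟩
  obtain ⟨b, hb, hba⟩ := h1
  rwa [← Subtype.ext hba]

/-- Finitely generated subgroups with finitely many sections at some vertex are limits of subgroups
of the same kind. -/
theorem mem_perfectKernel_of_finite_sections [Finite X] [Infinite G]
    (hK : IsBranchingSubgroup K G) (happ : WellApproximatedSubgroups G) {H : Subgroup G}
    (hfg : H.FG) {y : List X}
    (hy : (treeSection y '' (H.map G.subtype : Set (TreeAut X))).Finite) :
    H ∈ perfectKernel (Set.univ : Set (Subgroup G)) := by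
  have := nontrivial_of_infinite (G := G)
  set F : Set (Subgroup G) :=
    {M | M.FG ∧ ∃ y, (treeSection y '' (M.map G.subtype : Set (TreeAut X))).Finite}
  have hF : Preperfect F := by
    rintro M ⟨hM, y, hy⟩
    rw [accPt_iff_frequently]
    choose g hgG hgs hgM v hv using fun n => exists_adjoin_finite_sections hK hy n
    set N : ℕ → Subgroup G := fun n => M ⊔ Subgroup.closure {⟨g n, hgG n⟩}
    have hN : ∀ n, (N n).map G.subtype =
        Subgroup.closure ((M.map G.subtype : Set (TreeAut X)) ∪ {g n}) := by
      intro n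
      rw [Subgroup.map_sup, MonoidHom.map_closure, Set.image_singleton, Subgroup.closure_union,
        Subgroup.closure_eq]
      rfl
    have hlim : Tendsto N atTop (𝓝 M) := by
      rw [tendsto_nhds_subgroup_iff]
      intro a
      by_cases ha : a ∈ M
      · exact Eventually.of_forall fun n => ⟨fun _ => ha, fun _ => Subgroup.mem_sup_left ha⟩
      · obtain ⟨k, hk⟩ := exists_notMem_sup_stab happ hM ha
        filter_upwards [eventually_ge_atTop k] with n hn
        refine ⟨fun h => absurd (sup_le_sup_left ?_ M h) hk, fun h => absurd h ha⟩
        rw [Subgroup.closure_le, Set.singleton_subset_iff]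
        exact stab_level_antitone hn (hgs n)
    refine hlim.frequently (Frequently.of_forall fun n => ⟨fun h => hgM n ?_, ?_, v n, ?_⟩)
    · refine ⟨⟨g n, hgG n⟩, ?_, rfl⟩
      rw [SetLike.mem_coe, ← h]
      exact Subgroup.mem_sup_right (Subgroup.subset_closure rfl)
    · exact hM.sup ⟨{⟨g n, hgG n⟩}, by simp⟩
    · rw [hN]
      exact hv n
  refine Set.mem_iInter.mpr fun a => iteratedDerivedSet_mono (Set.subset_univ F) a ?_
  change H ∈ iteratedDerivedSet F a
  rw [iteratedDerivedSet_constant_iff_preperfect.mp hF a]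
  exact ⟨hfg, y, hy⟩

/-! ### Commensurators -/

theorem conjAct_smul_eq_map {A : Type*} [Group A] (e : A) (M : Subgroup A) :
    ConjAct.toConjAct e • M = M.map (MulAut.conj e).toMonoidHom :=
  rfl

theorem le_commensurator {A : Type*} [Group A] {M M' : Subgroup A} (hM : M ≤ M')
    (h : M.relIndex M' ≠ 0) : M' ≤ Subgroup.Commensurable.commensurator M := by
  intro e he
  have h1 : ConjAct.toConjAct e • M' = M' := by
    apply le_antisymm
    · rintro _ ⟨a, ha, rfl⟩
      exact M'.mul_mem (M'.mul_mem he ha) (M'.inv_mem he)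
    · intro a ha
      refine ⟨e⁻¹ * a * e, M'.mul_mem (M'.mul_mem (M'.inv_mem he) ha) he, ?_⟩
      change e * (e⁻¹ * a * e) * e⁻¹ = a
      group
  have h2 : (ConjAct.toConjAct e • M).relIndex M' ≠ 0 := by
    rwa [← h1, Subgroup.relIndex_pointwise_smul]
  have h3 : ConjAct.toConjAct e • M ≤ M' := by
    rw [← h1]
    exact Subgroup.pointwise_smul_le_pointwise_smul_iff.mpr hM
  exact ⟨fun h0 => h2 (Subgroup.relIndex_eq_zero_of_le_right hM h0),
    fun h0 => h (Subgroup.relIndex_eq_zero_of_le_right h3 h0)⟩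

/-! ### Overgroups of an infra-direct product -/

theorem ContainsInfraDirect.hasBoundedOvergroups [Finite X] (hG : JustInfinite G)
    (hs : SelfSimilar G) (ht : LevelTransitive G) (hK : IsBranchingSubgroup K G) {L : Subgroup G}
    (hL : ContainsInfraDirect G (L.map G.subtype)) : HasBoundedOvergroups L := by
  have := hG.1
  have := nontrivial_of_infinite (G := G)
  have hinj := G.subtype_injective
  have hup : ∀ M : Subgroup G, L ≤ M → ContainsInfraDirect G (M.map G.subtype) := fun M hM =>
    hL.mono hs (Subgroup.map_mono hM) (Subgroup.map_subtype_le M)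
  refine ⟨fun M hM => ?_, fun M hM => ⟨Subgroup.Commensurable.commensurator M, ?_, ?_⟩⟩
  · obtain ⟨c, hc⟩ := (hup M hM).exists_chain_bound hG hs ht hK
    refine ne_top_of_le_ne_top (ENat.natCast_ne_top c) (iSup₂_le fun n hn => Nat.cast_le.mpr ?_)
    obtain ⟨H, h0, rfl, hH⟩ := hn
    -- read the chain from its bottom upwards
    refine hc n (fun i => (H (n - i)).map G.subtype) (monotone_nat_of_le_succ fun i => ?_) le_rfl
      (fun i => Subgroup.map_subtype_le _) fun i hi => ?_
    · refine Subgroup.map_mono ?_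
      rcases Nat.lt_or_ge i n with hi | hi
      · have := (hH (n - (i + 1)) (by omega)).1.le
        rwa [show n - (i + 1) + 1 = n - i by omega] at this
      · rw [Nat.sub_eq_zero_of_le hi, Nat.sub_eq_zero_of_le (by omega)]
    · have := (hH (n - (i + 1)) (by omega)).2
      rw [show n - (i + 1) + 1 = n - i by omega] at this
      rwa [Subgroup.relIndex_map_map_of_injective _ _ hinj]
  · rw [← Subgroup.relIndex_map_map_of_injective _ _ hinj]
    refine (hup M hM).relIndex_ne_zero_of_commensurates hG hs ht hK (Subgroup.map_mono ?_)
      (Subgroup.map_subtype_le _) ?_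
    · exact le_commensurator le_rfl (by rw [Subgroup.relIndex_self]; exact one_ne_zero)
    · rintro _ ⟨e, he, rfl⟩
      have h1 : (M.map G.subtype).map (MulAut.conj (G.subtype e)).toMonoidHom =
          (ConjAct.toConjAct e • M).map G.subtype := by
        rw [conjAct_smul_eq_map, Subgroup.map_map, Subgroup.map_map]
        rfl
      rw [Subgroup.relIndex_comap, h1, Subgroup.relIndex_map_map_of_injective _ _ hinj]
      exact he.2
  · exact fun M' hM' h => le_commensurator hM' h

end

end BranchSub

open BranchSub in
theorem mainTheorem4 {X : Type u} [Finite X] (G : Subgroup (BranchSub.TreeAut X))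
    (hfg : G.FG)
    (hbranch : BranchSub.RegularBranch G)
    (hji : BranchSub.JustInfinite G)
    (hrep : BranchSub.StronglySelfReplicating G)
    (happ : BranchSub.WellApproximatedSubgroups G)
    (halt : BranchSub.GrigorchukNagnibedaAlternative G)
    (L : Subgroup G)
    (hL : L ∉ CantorBendixson.perfectKernel (Set.univ : Set (Subgroup G))) :
    L.FG ∧
      BranchSub.cbRank L < ((Ordinal.omega0 : Ordinal.{u}) : WithTop Ordinal.{u}) ∧
      BranchSub.cbRank L =
        ENat.map (fun n : ℕ => (n : Ordinal.{u})) (BranchSub.depth L) := by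
  obtain ⟨hs, ht, K, hK⟩ := hbranch
  have := hji.1
  have := nontrivial_of_infinite (G := G)
  obtain ⟨H, hHL, hH, hHk⟩ :=
    exists_fg_le_notMem (CantorBendixson.isClosed_perfectKernel isClosed_univ) hL
  have hinfra : ContainsInfraDirect G (H.map G.subtype) :=
    (halt _ (Subgroup.map_subtype_le H) (fg_map_subtype hH)).resolve_left fun ⟨y, hy⟩ =>
      hHk (mem_perfectKernel_of_finite_sections hK happ hH hy)
  have hB := hinfra.hasBoundedOvergroups hji hs ht hK
  obtain ⟨d, hd, hr⟩ := hB.cbRank_eq hH (st := fun n => (stab (level X n)).subgroupOf G)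
    (fun m n hmn => Subgroup.comap_mono (stab_level_antitone hmn))
    (fun n => relIndex_stab_ne_zero (finite_level n) G)
    (fun M hM a ha => exists_notMem_sup_stab happ hM ha) hHL
  refine ⟨hB.fg hH hHL, ?_, ?_⟩
  · rw [hr]
    exact WithTop.coe_lt_coe.mpr (Ordinal.natCast_lt_omega0 d)
  · rw [hr, hd]
    rfl
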